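/- Equip $\mathbb{R}^{n+m}=\mathbb{R}^n\times\mathbb{R}^m$ with the Euclidean norm $|\cdot|$ and distance $d$. For $\varphi:\mathbb{R}^{n+m}\to\mathbb{R}$ put $\mathbf f=(\varphi_x,-\varphi_y)$; for a convex set $K$ and $\mathbf z\in K$ let $N_K(\mathbf z)=\{v: v^T(w-\mathbf z)\le 0\ \forall w\in K\}$ be the normal cone, and let $\mathbf P_A$ denote the projection onto a non-empty closed convex set $A$. A function is concave-convex on a convex set $C\subseteq\mathbb{R}^{n+m}$ if on the slices of $C$ it is concave in $x$ for each fixed $y$ and convex in $y$ for each fixed $x$. A point $\bar{\mathbf z}=(\bar x,\bar y)\in K$ is a $K$-restricted saddle point of $\varphi$ if $\varphi(x,\bar y)\le\varphi(\bar x,\bar y)\le\varphi(\bar x,y)$ whenever $(x,\bar y),(\bar x,y)\in K$, and $\mathbf f(\bar{\mathbf z})\in N_K(\bar{\mathbf z})$ (if $K$ is a product of convex sets $X\subseteq\mathbb{R}^n$, $Y\subseteq\mathbb{R}^m$, the second condition follows from the first; if $\varphi$ is concave-convex on $K$, the first follows from the second). A face of $K$ is a convex subset $F\subseteq K$ that contains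 every segment in $K$ whose relative interior meets $F$; the minimal face containing a set is the intersection of all faces containing it. The subgradient method on $K$ consists of the Carathéodory solutions $\mathbf z:[0,\infty)\to K$ (locally absolutely continuous, equation satisfied for almost all $t$) of $$\dot{\mathbf z}=\mathbf f(\mathbf z)-\mathbf P_{N_K(\mathbf z)}(\mathbf f(\mathbf z)),$$ and its $\omega$-limit set is $\Omega=\bigcup_{\mathbf z}\bigcap_{t\ge0}\overline{\mathbf z([t,\infty))}$, the union being over all these solutions. **Theorem.** Let $K\subseteq\mathbb{R}^{n+m}$ be closed and convex. Let $\varphi:\mathbb{R}^{n+m}\to\mathbb{R}$ be $C^2$ and concave-convex on a convex set $C\supseteq K$ whose affine hull is a product of an affine subspace of $\mathbb{R}^n$ and an affine subspace of $\mathbb{R}^m$ (for example $C=K$ if $K$ has interior points or is a product $X\times Y$; or $C=\mathbb{R}^{n+m}$). Assume that $\varphi$ has a $K$-restricted saddle point. Then $\Omega$ is convex, and there is a flow $\psi:\mathbb{R}\times\Omega\to\Omega$ of isometries of $(\Omega,d)$ which for $t\ge0$ is the subgradient method on $K$: for each $p\in\Omega$ the map $t\mapsto\psi(t,p)$, $t\ge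 0$, is a solution of the subgradient method on $K$, and the only one starting at $p$. Moreover: (i) Let $V$ be the affine span of the minimal face of $K$ containing all $K$-restricted saddle points. Every trajectory $\mathbf z(t)=\psi(t,p)$, $p\in\Omega$, $t\in\mathbb{R}$, lies in $V$ and solves the subgradient method on $V$, that is, for all $t\in\mathbb{R}$, $$\dot{\mathbf z}=\mathbf f(\mathbf z)-\mathbf P_{N_V}(\mathbf f(\mathbf z)),$$ where $N_V$ is the normal cone to $V$ (the same at all points of $V$). (ii) Call the $C$-restricted saddle points of $\varphi$ its saddle points (for $C=\mathbb{R}^{n+m}$ these are the usual saddle points). Let $\mathcal S$ be the set of solutions $\mathbf z:\mathbb{R}\to\mathbb{R}^{n+m}$ of the gradient method $\dot x=\varphi_x$, $\dot y=-\varphi_y$ whose distance from each saddle point of $\varphi$ is constant in time. If $\varphi$ has a saddle point in the interior of $K$, then the trajectories of $\psi$ are exactly the $\mathbf z\in\mathcal S$ with $\mathbf z(\mathbb{R})\subseteq K$, and $$\Omega=\{\mathbf z(t):\ t\in\mathbb{R},\ \mathbf z\in\mathcal S,\ \mathbf z(\mathbb{R})\subseteq K\}.$$ -/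

import Mathlib

open Set Filter Topology MeasureTheory

namespace SubgradientFaces

/-- The Euclidean space `ℝⁿ⁺ᵐ`, with coordinates indexed by the disjoint union of the indices of
the coordinates of `x ∈ ℝⁿ` and of `y ∈ ℝᵐ`. -/
abbrev Pt (n m : ℕ) : Type := EuclideanSpace ℝ (Fin n ⊕ Fin m)

/-- The point `(x, y)` of `ℝⁿ⁺ᵐ`. -/
def pt {n m : ℕ} (x : EuclideanSpace ℝ (Fin n)) (y : EuclideanSpace ℝ (Fin m)) : Pt n m :=
  WithLp.toLp 2 (Sum.elim x y)

/-- The component `x` of `z = (x, y)`. -/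
def xPart {n m : ℕ} (z : Pt n m) : EuclideanSpace ℝ (Fin n) :=
  WithLp.toLp 2 (fun i => z (Sum.inl i))

/-- The component `y` of `z = (x, y)`. -/
def yPart {n m : ℕ} (z : Pt n m) : EuclideanSpace ℝ (Fin m) :=
  WithLp.toLp 2 (fun j => z (Sum.inr j))

/-- `φ` is concave-convex on `C`: concave in `x` for fixed `y`, and convex in `y` for fixed `x`,
on the slices of `C`. -/
def ConcaveConvexOn {n m : ℕ} (C : Set (Pt n m)) (φ : Pt n m → ℝ) : Prop :=
  (∀ y, ConcaveOn ℝ {x | pt x y ∈ C} (fun x => φ (pt x y))) ∧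
    ∀ x, ConvexOn ℝ {y | pt x y ∈ C} (fun y => φ (pt x y))

/-- The affine hull of `C` is the product of an affine subspace of `ℝⁿ` and one of `ℝᵐ`. -/
def HasProductSpan {n m : ℕ} (C : Set (Pt n m)) : Prop :=
  ∃ (A : AffineSubspace ℝ (EuclideanSpace ℝ (Fin n)))
    (B : AffineSubspace ℝ (EuclideanSpace ℝ (Fin m))),
    ∀ z : Pt n m, z ∈ affineSpan ℝ C ↔ xPart z ∈ A ∧ yPart z ∈ B

/-- The vector field `f = (φ_x, -φ_y)` of the gradient method. -/
noncomputable def gradField {n m : ℕ} (φ : Pt n m → ℝ) (z : Pt n m) : Pt n m :=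
  pt (xPart (gradient φ z)) (-yPart (gradient φ z))

section Convex

variable {E : Type*} [NormedAddCommGroup E] [InnerProductSpace ℝ E]

/-- The normal cone `N_K(z)` to `K` through a point `z` of `K`. -/
def normalCone (K : Set E) (z : E) : Set E :=
  {v | ∀ w ∈ K, inner ℝ v (w - z) ≤ 0}

open Classical in
/-- The metric projection `P_C(v)`: the point of `C` nearest to `v`. It exists and is unique for
every non-empty closed convex `C` in a Euclidean space, in particular for every normal cone to `K`
through a point of `K`; the value `0` otherwise is never used. -/
noncomputable def proj (C : Set E) (v : E) : E :=
  if h : ∃ p ∈ C, ∀ q ∈ C, dist v p ≤ dist v q then h.choose else 0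

/-- `F` is a face of the convex set `K`: a convex subset of `K` such that every segment in `K`
whose relative interior meets `F` has its end points (hence all of its points) in `F`. -/
def IsFace (K F : Set E) : Prop :=
  Convex ℝ F ∧ IsExtreme ℝ K F

/-- The minimal face of `K` containing `A`. -/
def minimalFace (K A : Set E) : Set E :=
  ⋂₀ {F | IsFace K F ∧ A ⊆ F}

end Convex

/-- The saddle point inequalities `φ(x, ȳ) ≤ φ(x̄, ȳ) ≤ φ(x̄, y)` at the point `z = (x̄, ȳ)` of `K`,
for all `x`, `y` with `(x, ȳ) ∈ K` and `(x̄, y) ∈ K`. -/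
def SaddleInequalities {n m : ℕ} (φ : Pt n m → ℝ) (K : Set (Pt n m)) (z : Pt n m) : Prop :=
  z ∈ K ∧ (∀ x, pt x (yPart z) ∈ K → φ (pt x (yPart z)) ≤ φ z) ∧
    ∀ y, pt (xPart z) y ∈ K → φ z ≤ φ (pt (xPart z) y)

/-- `z` is a `K`-restricted saddle point of `φ`: the saddle point inequalities hold in `K`, and
`(φ_x, -φ_y)` lies in the normal cone to `K` through `z`. For `K = X ×ˢ Y` the second condition
follows from the first (`SaddleInequalities.isRestrictedSaddle`), and for `φ` concave-convex on
`K` the first follows from the second (`isRestrictedSaddle_iff_mem_normalCone`). For `K` the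
whole space this is the usual notion of a saddle point. -/
def IsRestrictedSaddle {n m : ℕ} (φ : Pt n m → ℝ) (K : Set (Pt n m)) (z : Pt n m) : Prop :=
  SaddleInequalities φ K z ∧ gradField φ z ∈ normalCone K z

/-- The (discontinuous) vector field `f(z) - P_{N_K(z)}(f(z))` of the subgradient method on `K`. -/
noncomputable def subgradField {n m : ℕ} (φ : Pt n m → ℝ) (K : Set (Pt n m)) (z : Pt n m) :
    Pt n m :=
  gradField φ z - proj (normalCone K z) (gradField φ z)

/-- `z : [0, ∞) → K` (extended arbitrarily to negative times) is a trajectory of the subgradient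
method on `K`, that is, a Carathéodory solution of `ż = f(z) - P_{N_K(z)}(f(z))` in `K`. -/
structure IsSubgradTrajectory {n m : ℕ} (φ : Pt n m → ℝ) (K : Set (Pt n m)) (z : ℝ → Pt n m) :
    Prop where
  mem : ∀ t, 0 ≤ t → z t ∈ K
  absolutelyContinuous : ∀ T, 0 ≤ T → AbsolutelyContinuousOnInterval z 0 T
  hasDerivAt : ∀ᵐ t ∂(volume : Measure ℝ), 0 < t → HasDerivAt z (subgradField φ K (z t)) t

/-- The `ω`-limit set of the subgradient method on `K`: the union over all trajectories `z` of
`⋂_{t ≥ 0} closure (z([t, ∞)))`. -/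
def omegaLimitSet {n m : ℕ} (φ : Pt n m → ℝ) (K : Set (Pt n m)) : Set (Pt n m) :=
  {p | ∃ z, IsSubgradTrajectory φ K z ∧ ∀ t, 0 ≤ t → p ∈ closure (z '' Ici t)}

/-- The affine span of the minimal face of `K` that contains all `K`-restricted saddle points. -/
noncomputable def saddleSpan {n m : ℕ} (φ : Pt n m → ℝ) (K : Set (Pt n m)) : AffineSubspace ℝ (Pt n m) :=
  affineSpan ℝ (minimalFace K {z | IsRestrictedSaddle φ K z})

/-- The set `𝒮` of the solutions `z : ℝ → ℝⁿ⁺ᵐ` of the gradient method `ẋ = φ_x`, `ẏ = -φ_y`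
that lie at a constant distance from every saddle point of the function `φ` on `C`. -/
def constDistSolutions {n m : ℕ} (φ : Pt n m → ℝ) (C : Set (Pt n m)) : Set (ℝ → Pt n m) :=
  {z | (∀ t, HasDerivAt z (gradField φ (z t)) t) ∧
    ∀ q, IsRestrictedSaddle φ C q → ∃ c : ℝ, ∀ t, dist (z t) q = c}


/-- A set with non-empty interior has a product as its affine hull. -/
theorem hasProductSpan_of_interior {n m : ℕ} {C : Set (Pt n m)} (h : (interior C).Nonempty) :
    HasProductSpan C :=
  ⟨⊤, ⊤, fun z => by simp [affineSpan_eq_top_of_nonempty_interior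
    (h.mono (interior_mono (subset_convexHull ℝ C)))]⟩

/-- A product has a product as its affine hull. -/
theorem hasProductSpan_of_prod {n m : ℕ} {X : Set (EuclideanSpace ℝ (Fin n))}
    {Y : Set (EuclideanSpace ℝ (Fin m))} :
    HasProductSpan {z : Pt n m | xPart z ∈ X ∧ yPart z ∈ Y} := by
  refine ⟨affineSpan ℝ X, affineSpan ℝ Y, fun z => ⟨fun hz => ?_, fun hz => ?_⟩⟩
  · refine affineSpan_induction hz (fun w hw => ⟨subset_affineSpan ℝ X hw.1,
      subset_affineSpan ℝ Y hw.2⟩) (fun c u v w hu hv hw => ⟨?_, ?_⟩)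
    · exact AffineSubspace.smul_vsub_vadd_mem _ c hu.1 hv.1 hw.1
    · exact AffineSubspace.smul_vsub_vadd_mem _ c hu.2 hv.2 hw.2
  · have key : ∀ x ∈ affineSpan ℝ X, ∀ y ∈ Y,
        pt x y ∈ affineSpan ℝ {z : Pt n m | xPart z ∈ X ∧ yPart z ∈ Y} := by
      intro x hx y hy
      refine affineSpan_induction hx (fun w hw => subset_affineSpan ℝ _ ⟨hw, hy⟩)
        (fun c u v w hu hv hw => ?_)
      have := AffineSubspace.smul_vsub_vadd_mem _ c hu hv hw
      convert! this using 1
      ext i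
      rcases i with i | i <;> simp [pt]
    have key2 : ∀ x ∈ affineSpan ℝ X, ∀ y ∈ affineSpan ℝ Y,
        pt x y ∈ affineSpan ℝ {z : Pt n m | xPart z ∈ X ∧ yPart z ∈ Y} := by
      intro x hx y hy
      refine affineSpan_induction hy (fun w hw => key x hx w hw) (fun c u v w hu hv hw => ?_)
      have := AffineSubspace.smul_vsub_vadd_mem _ c hu hv hw
      convert! this using 1
      ext i
      rcases i with i | i <;> simp [pt]
    have := key2 _ hz.1 _ hz.2
    convert! this using 1
    ext i
    rcases i with i | i <;> rfl

theorem inner_gradField {n m : ℕ} (φ : Pt n m → ℝ) (z w : Pt n m) :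
    inner ℝ (gradField φ z) (w - z) =
      fderiv ℝ φ z (pt (xPart w) (yPart z) - z) - fderiv ℝ φ z (pt (xPart z) (yPart w) - z) := by
  have h : ∀ v, fderiv ℝ φ z v = inner ℝ (gradient φ z) v := fun v => by
    simp [gradient]
  rw [h, h]
  simp only [PiLp.inner_apply, gradField, pt, xPart, yPart, Fintype.sum_sum_type]
  simp
  ring

theorem pt_parts {n m : ℕ} (z : Pt n m) : pt (xPart z) (yPart z) = z := by
  ext i
  rcases i with i | i <;> rfl

/-- The first order condition at the end point of a segment. -/
theorem fderiv_nonneg_of_segment {n m : ℕ} {φ : Pt n m → ℝ} {z w : Pt n m} {c : ℝ}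
    (hφ : DifferentiableAt ℝ φ z)
    (h : ∀ s ∈ Icc (0 : ℝ) 1, φ z + s * c ≤ φ (z + s • (w - z))) :
    c ≤ fderiv ℝ φ z (w - z) := by
  have h1 : HasDerivAt (fun s : ℝ => z + s • (w - z)) (w - z) 0 := by
    simpa using ((hasDerivAt_id (0 : ℝ)).smul_const (w - z)).const_add z
  have h2 : HasFDerivAt φ (fderiv ℝ φ z) (z + (0 : ℝ) • (w - z)) := by
    simpa using hφ.hasFDerivAt
  have h3 : HasDerivAt (fun s : ℝ => φ (z + s • (w - z)) - s * c)
      (fderiv ℝ φ z (w - z) - c) 0 := by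
    have h := (h2.comp_hasDerivAt 0 h1).sub ((hasDerivAt_id (0 : ℝ)).mul_const c)
    rw [one_mul] at h
    exact h
  have h4 : IsMinOn (fun s : ℝ => φ (z + s • (w - z)) - s * c) (Icc 0 1) 0 := by
    intro s hs
    have := h s hs
    simp only [mem_ofPred_eq, zero_smul, add_zero, zero_mul, sub_zero]
    linarith
  have h6 : (1 : ℝ) ∈ posTangentConeAt (Icc (0 : ℝ) 1) 0 := by
    have := sub_mem_posTangentConeAt_of_segment_subset (segment_eq_Icc (zero_le_one' ℝ)).subset
    simpa using this
  have h5 := h4.localize.hasFDerivWithinAt_nonneg h3.hasFDerivAt.hasFDerivWithinAt h6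
  rw [ContinuousLinearMap.toSpanSingleton_apply, one_smul] at h5
  linarith

theorem segment_x {n m : ℕ} (z w : Pt n m) (s : ℝ) :
    z + s • (pt (xPart w) (yPart z) - z) =
      pt ((1 - s) • xPart z + s • xPart w) (yPart z) := by
  ext i
  rcases i with i | i <;> simp [pt, xPart, yPart]
  ring

theorem segment_y {n m : ℕ} (z w : Pt n m) (s : ℝ) :
    z + s • (pt (xPart z) (yPart w) - z) =
      pt (xPart z) ((1 - s) • yPart z + s • yPart w) := by
  ext i
  rcases i with i | i <;> simp [pt, xPart, yPart]
  ring

/-- On a product, the saddle point inequalities say that `z` is a restricted saddle point. -/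
theorem SaddleInequalities.isRestrictedSaddle {n m : ℕ} {φ : Pt n m → ℝ}
    {X : Set (EuclideanSpace ℝ (Fin n))} {Y : Set (EuclideanSpace ℝ (Fin m))}
    (hX : Convex ℝ X) (hY : Convex ℝ Y) (hφ : Differentiable ℝ φ) {z : Pt n m}
    (h : SaddleInequalities φ {z : Pt n m | xPart z ∈ X ∧ yPart z ∈ Y} z) :
    IsRestrictedSaddle φ {z : Pt n m | xPart z ∈ X ∧ yPart z ∈ Y} z := by
  refine ⟨h, fun w hw => ?_⟩
  rw [inner_gradField]
  obtain ⟨hz, hx, hy⟩ := h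
  have h1 : (0 : ℝ) ≤ fderiv ℝ φ z (pt (xPart z) (yPart w) - z) := by
    refine fderiv_nonneg_of_segment (hφ z) fun s hs => ?_
    rw [segment_y, mul_zero, add_zero]
    exact hy _ ⟨hz.1, hY hz.2 hw.2 (by linarith [hs.2]) hs.1 (by ring)⟩
  have h2 : (0 : ℝ) ≤ fderiv ℝ (-φ) z (pt (xPart w) (yPart z) - z) := by
    refine fderiv_nonneg_of_segment (hφ z).neg fun s hs => ?_
    rw [segment_x, mul_zero, add_zero]
    exact neg_le_neg (hx _ ⟨hX hz.1 hw.1 (by linarith [hs.2]) hs.1 (by ring), hz.2⟩)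
  rw [fderiv_neg] at h2
  simp only [neg_apply] at h2
  linarith

/-- For `φ` concave-convex on `K`, the normal cone condition implies the inequalities. -/
theorem isRestrictedSaddle_iff_mem_normalCone {n m : ℕ} {φ : Pt n m → ℝ} {K : Set (Pt n m)}
    (hφ : Differentiable ℝ φ) (hK : ConcaveConvexOn K φ) {z : Pt n m} :
    IsRestrictedSaddle φ K z ↔ z ∈ K ∧ gradField φ z ∈ normalCone K z := by
  refine ⟨fun h => ⟨h.1.1, h.2⟩, fun ⟨hz, hN⟩ => ⟨⟨hz, fun x hx => ?_, fun y hy => ?_⟩, hN⟩⟩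
  · have h1 := hN _ hx
    have h2 : φ (pt x (yPart z)) - φ z ≤ fderiv ℝ φ z (pt x (yPart z) - z) := by
      refine fderiv_nonneg_of_segment (hφ z) fun s hs => ?_
      have := (hK.1 (yPart z)).2 (x := xPart z) (by simpa [pt_parts] using hz) hx
        (sub_nonneg.2 hs.2) hs.1 (by ring)
      have e := segment_x z (pt x (yPart z)) s
      change z + s • (pt x (yPart z) - z) = pt ((1 - s) • xPart z + s • x) (yPart z) at e
      rw [e]
      simp only [pt_parts, smul_eq_mul] at this
      linarith
    rw [inner_gradField] at h1
    change fderiv ℝ φ z (pt x (yPart z) - z) - fderiv ℝ φ z (pt (xPart z) (yPart z) - z) ≤ 0 at h1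
    rw [pt_parts, sub_self, map_zero] at h1
    linarith
  · have h1 := hN _ hy
    have h2 : -(φ (pt (xPart z) y) - φ z) ≤ fderiv ℝ (-φ) z (pt (xPart z) y - z) := by
      refine fderiv_nonneg_of_segment (hφ z).neg fun s hs => ?_
      have := (hK.2 (xPart z)).2 (x := yPart z) (by simpa [pt_parts] using hz) hy
        (sub_nonneg.2 hs.2) hs.1 (by ring)
      have e := segment_y z (pt (xPart z) y) s
      change z + s • (pt (xPart z) y - z) = pt (xPart z) ((1 - s) • yPart z + s • y) at e
      rw [e]
      simp only [pt_parts, smul_eq_mul] at this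
      simp only [Pi.neg_apply]
      linarith
    rw [fderiv_neg] at h2
    simp only [neg_apply] at h2
    rw [inner_gradField] at h1
    change fderiv ℝ φ z (pt (xPart z) (yPart z) - z) - fderiv ℝ φ z (pt (xPart z) y - z) ≤ 0 at h1
    rw [pt_parts, sub_self, map_zero] at h1
    linarith

end SubgradientFaces

/-!
For `φ` concave-convex the field `f = (φ_x, -φ_y)` is dissipative, `⟪f z - f w, z - w⟫ ≤ 0`, so the
projected equation does not increase distances. A compactness argument then shows that `Ω` consists
of the starting points of the recurrent trajectories, those that lie in their own `ω`-limit set.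
Two recurrent trajectories return to their starting points simultaneously, so their distance is
constant, and the semiflow on `Ω` is isometric and surjective: it extends to a flow.

Where the distance of two trajectories is constant, its derivative, a sum of nonpositive terms,
vanishes term by term. Hence their convex combinations are trajectories, and `Ω` is convex. For a
recurrent trajectory and an equilibrium it follows that the normal component of `f` is orthogonal to
the minimal face of the equilibria. The trajectory lies in that face: on the part of `Ω` in a ball
about an equilibrium, the flow acts by isometries and preserves a closed substitute for the relative
interior, whose point nearest to the equilibrium is therefore an equilibrium too.

At an interior saddle point `q` the derivative of the dissipative field `f` is semidefinite, which
gives the converse in (ii): a solution of `ż = f z` at constant distance from `q` obeys a linear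
equation with skew generator and is recurrent.
-/

open scoped NNReal

namespace SubgradientFaces

section AbsolutelyContinuous

theorem absolutelyContinuousOnInterval_lipschitzWith_comp {X Y : Type*} [PseudoMetricSpace X]
    [PseudoMetricSpace Y] {g : X → Y} {C : ℝ≥0} (hg : LipschitzWith C g) {u : ℝ → X} {a b : ℝ}
    (hu : AbsolutelyContinuousOnInterval u a b) :
    AbsolutelyContinuousOnInterval (g ∘ u) a b := by
  have hlim := Tendsto.const_mul (C : ℝ) hu
  rw [mul_zero] at hlim
  refine squeeze_zero (fun P => Finset.sum_nonneg fun i _ => dist_nonneg) (fun P => ?_) hlim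
  rw [Finset.mul_sum]
  exact Finset.sum_le_sum fun i _ => hg.dist_le_mul _ _

theorem absolutelyContinuousOnInterval_comp_const_add {X : Type*} [PseudoMetricSpace X]
    {u : ℝ → X} {a b c : ℝ} (hu : AbsolutelyContinuousOnInterval u (a + b) (a + c)) :
    AbsolutelyContinuousOnInterval (fun t => u (a + t)) b c := by
  rw [absolutelyContinuousOnInterval_iff] at hu ⊢
  intro ε hε
  obtain ⟨δ, hδ, h⟩ := hu ε hε
  refine ⟨δ, hδ, fun P hP hPδ => h (P.1, fun i => (a + (P.2 i).1, a + (P.2 i).2)) ⟨?_, ?_⟩ ?_⟩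
  · simpa only [← Set.image_const_add_uIcc, mem_image, add_right_inj, exists_eq_right] using hP.1
  · intro i hi j hj hij
    have := (hP.2 hi hj hij).image (f := (a + ·)) (add_right_injective a).injOn
      (subset_univ _) (subset_univ _)
    simpa only [Function.onFun, uIoc, Set.image_const_add_Ioc, min_add_add_left,
      max_add_add_left] using this
  · simpa only [dist_add_left] using hPδ

theorem absolutelyContinuousOnInterval_norm_sq {E : Type*} [SeminormedAddCommGroup E]
    {z : ℝ → E} {a b : ℝ} (hz : AbsolutelyContinuousOnInterval z a b) :
    AbsolutelyContinuousOnInterval (fun t => ‖z t‖ ^ 2) a b := by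
  have hnorm := absolutelyContinuousOnInterval_lipschitzWith_comp lipschitzWith_one_norm hz
  simpa only [sq, Function.comp_def] using hnorm.fun_mul hnorm

theorem le_of_ae_hasDerivAt_nonpos {g : ℝ → ℝ} {a b : ℝ} (hab : a ≤ b)
    (hg : AbsolutelyContinuousOnInterval g a b)
    (hderiv : ∀ᵐ t : ℝ, t ∈ Ioo a b → ∃ d ≤ 0, HasDerivAt g d t) : g b ≤ g a := by
  have hint : ∫ t in a..b, deriv g t ≤ 0 := by
    rw [intervalIntegral.integral_of_le hab, integral_Ioc_eq_integral_Ioo]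
    refine setIntegral_nonpos_of_ae_restrict ((ae_restrict_iff' measurableSet_Ioo).2 ?_)
    filter_upwards [hderiv] with t ht htmem
    obtain ⟨d, hd, hderiv⟩ := ht htmem
    exact hderiv.deriv.trans_le hd
  rw [hg.integral_deriv_eq_sub] at hint
  linarith

variable {E : Type*} [NormedAddCommGroup E] [InnerProductSpace ℝ E]

theorem dist_le_of_ae_hasDerivAt {z : ℝ → E} {a b : ℝ} {C : ℝ≥0} (hab : a ≤ b)
    (hz : AbsolutelyContinuousOnInterval z a b)
    (hderiv : ∀ᵐ t : ℝ, t ∈ Ioo a b → ∃ d, ‖d‖ ≤ C ∧ HasDerivAt z d t) :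
    dist (z a) (z b) ≤ C * (b - a) := by
  set e := z b - z a with he
  have hinner : AbsolutelyContinuousOnInterval (fun t => inner ℝ e (z t)) a b :=
    absolutelyContinuousOnInterval_lipschitzWith_comp (innerSL ℝ e).lipschitz hz
  have hlinear : AbsolutelyContinuousOnInterval (fun t => ‖e‖ * C * t) a b :=
    ContDiffOn.absolutelyContinuousOnInterval (by fun_prop)
  have hle := le_of_ae_hasDerivAt_nonpos hab (hinner.fun_sub hlinear) (by
    filter_upwards [hderiv] with t ht htmem
    obtain ⟨d, hd, hzt⟩ := ht htmem
    refine ⟨_, ?_, ((hasDerivAt_const t e).inner ℝ hzt).fun_sub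
      ((hasDerivAt_id t).const_mul (‖e‖ * C))⟩
    have : inner ℝ e d ≤ ‖e‖ * C := (real_inner_le_norm e d).trans (by gcongr)
    simp only [inner_zero_left, add_zero, mul_one]
    linarith)
  have hsq : ‖e‖ * ‖e‖ ≤ ‖e‖ * (C * (b - a)) := by
    rw [← real_inner_self_eq_norm_mul_norm]
    nth_rewrite 2 [he]
    rw [inner_sub_right]
    linarith
  rw [dist_comm, dist_eq_norm]
  rcases (norm_nonneg e).eq_or_lt with h0 | hpos
  · rw [← he, ← h0]
    exact mul_nonneg C.coe_nonneg (sub_nonneg.2 hab)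
  · exact le_of_mul_le_mul_left hsq hpos

end AbsolutelyContinuous

section NormalCone

variable {E : Type*} [NormedAddCommGroup E] [InnerProductSpace ℝ E]

theorem norm_sq_add_norm_sq_le_of_inner_nonpos {v p q : E} (h : inner ℝ (v - p) (q - p) ≤ 0) :
    ‖v - p‖ ^ 2 + ‖q - p‖ ^ 2 ≤ ‖v - q‖ ^ 2 := by
  rw [← sub_sub_sub_cancel_right v q p, norm_sub_sq_real (v - p)]
  linarith

theorem proj_eq_of_inner_le {A : Set E} {v p : E} (hp : p ∈ A)
    (h : ∀ q ∈ A, inner ℝ (v - p) (q - p) ≤ 0) : proj A v = p := by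
  have hex : ∃ p ∈ A, ∀ q ∈ A, dist v p ≤ dist v q := by
    refine ⟨p, hp, fun q hq => ?_⟩
    rw [dist_eq_norm, dist_eq_norm]
    refine le_of_sq_le_sq ?_ (norm_nonneg _)
    linarith [norm_sq_add_norm_sq_le_of_inner_nonpos (h q hq), sq_nonneg ‖q - p‖]
  rw [proj, dif_pos hex]
  obtain ⟨hmem, hmin⟩ := hex.choose_spec
  have hsq := pow_le_pow_left₀ dist_nonneg (hmin p hp) 2
  rw [dist_eq_norm, dist_eq_norm] at hsq
  have hzero : ‖hex.choose - p‖ ^ 2 ≤ 0 := by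
    linarith [norm_sq_add_norm_sq_le_of_inner_nonpos (h _ hmem)]
  exact sub_eq_zero.1 (norm_eq_zero.1 (pow_eq_zero_iff two_ne_zero |>.1
    (hzero.antisymm (sq_nonneg _))))

theorem proj_eq_self {A : Set E} {v : E} (hv : v ∈ A) : proj A v = v :=
  proj_eq_of_inner_le hv fun q _ => by simp

theorem proj_spec [CompleteSpace E] {A : Set E} (hne : A.Nonempty) (hcl : IsClosed A)
    (hconv : Convex ℝ A) (v : E) :
    proj A v ∈ A ∧ ∀ q ∈ A, inner ℝ (v - proj A v) (q - proj A v) ≤ 0 := by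
  obtain ⟨p, hp, hmin⟩ := exists_norm_eq_iInf_of_complete_convex hne hcl.isComplete hconv v
  have hinner := (norm_eq_iInf_iff_real_inner_le_zero hconv hp).1 hmin
  rw [proj_eq_of_inner_le hp hinner]
  exact ⟨hp, hinner⟩

theorem zero_mem_normalCone (K : Set E) (z : E) : (0 : E) ∈ normalCone K z := fun w _ => by simp

theorem isClosed_normalCone (K : Set E) (z : E) : IsClosed (normalCone K z) := by
  have hinter : normalCone K z = ⋂ w ∈ K, {v | inner ℝ v (w - z) ≤ 0} := by
    ext v; simp [normalCone]
  rw [hinter]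
  exact isClosed_biInter fun w _ => isClosed_le (by fun_prop) continuous_const

theorem add_mem_normalCone {K : Set E} {z v v' : E} (hv : v ∈ normalCone K z)
    (hv' : v' ∈ normalCone K z) : v + v' ∈ normalCone K z := fun w hw => by
  rw [inner_add_left]
  exact add_nonpos (hv w hw) (hv' w hw)

theorem smul_mem_normalCone {K : Set E} {z v : E} {a : ℝ} (ha : 0 ≤ a)
    (hv : v ∈ normalCone K z) : a • v ∈ normalCone K z := fun w hw => by
  rw [real_inner_smul_left]
  exact mul_nonpos_of_nonneg_of_nonpos ha (hv w hw)

theorem convex_normalCone (K : Set E) (z : E) : Convex ℝ (normalCone K z) :=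
  fun _ hv _ hv' _ _ ha hb _ =>
    add_mem_normalCone (smul_mem_normalCone ha hv) (smul_mem_normalCone hb hv')

theorem mem_normalCone_of_inner_eq_zero {K : Set E} {z z' v : E} (hv : v ∈ normalCone K z)
    (h : inner ℝ v (z' - z) = 0) : v ∈ normalCone K z' := fun w hw => by
  rw [← sub_sub_sub_cancel_right w z' z, inner_sub_right, h, sub_zero]
  exact hv w hw

theorem proj_normalCone_mem [CompleteSpace E] (K : Set E) (z v : E) :
    proj (normalCone K z) v ∈ normalCone K z :=
  (proj_spec ⟨0, zero_mem_normalCone K z⟩ (isClosed_normalCone K z) (convex_normalCone K z) v).1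

theorem norm_sub_proj_normalCone_le [CompleteSpace E] (K : Set E) (z v : E) :
    ‖v - proj (normalCone K z) v‖ ≤ ‖v‖ := by
  have hinner := (proj_spec ⟨0, zero_mem_normalCone K z⟩ (isClosed_normalCone K z)
    (convex_normalCone K z) v).2 0 (zero_mem_normalCone K z)
  have hsq := norm_sq_add_norm_sq_le_of_inner_nonpos hinner
  rw [sub_zero] at hsq
  exact le_of_sq_le_sq (by linarith [sq_nonneg ‖0 - proj (normalCone K z) v‖]) (norm_nonneg v)

theorem inner_sub_nonneg_of_mem_normalCone {K : Set E} {z w m n : E} (hz : z ∈ K) (hw : w ∈ K)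
    (hm : m ∈ normalCone K z) (hn : n ∈ normalCone K w) : 0 ≤ inner ℝ (m - n) (z - w) := by
  have hmw := hm w hw
  have hnz := hn z hz
  rw [← neg_sub z w, inner_neg_right] at hmw
  rw [inner_sub_left]
  linarith

theorem inner_eq_zero_of_mem_normalCone {K : Set E} {u : ℝ → E} {v n : E} {t : ℝ}
    (hu : HasDerivAt u v t) (hK : ∀ᶠ s in 𝓝 t, u s ∈ K) (hn : n ∈ normalCone K (u t)) :
    inner ℝ n v = 0 := by
  have hderiv : HasDerivAt (fun s => inner ℝ n (u s)) (inner ℝ n v) t := by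
    simpa using (hasDerivAt_const t n).inner ℝ hu
  refine IsLocalMax.hasDerivAt_eq_zero ?_ hderiv
  filter_upwards [hK] with s hs
  have := hn _ hs
  rw [inner_sub_right] at this
  linarith

theorem eq_sub_proj_of_hasDerivAt {K : Set E} {u : ℝ → E} {v w : E} {t : ℝ}
    (hu : HasDerivAt u v t) (hK : ∀ᶠ s in 𝓝 t, u s ∈ K) (hn : w - v ∈ normalCone K (u t)) :
    v = w - proj (normalCone K (u t)) w := by
  rw [proj_eq_of_inner_le hn fun q hq => ?_, sub_sub_cancel]
  rw [sub_sub_cancel, real_inner_comm, inner_sub_left,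
    inner_eq_zero_of_mem_normalCone hu hK hn, inner_eq_zero_of_mem_normalCone hu hK hq, sub_zero]

end NormalCone

section ProjTrajectory

variable {E : Type*} [NormedAddCommGroup E] [InnerProductSpace ℝ E]

/-- `f` is dissipative on `K`: the nonpositivity of the inner product makes the distance of two
solutions of `ż = f(z)` nonincreasing. -/
def DissipativeOn (f : E → E) (K : Set E) : Prop :=
  ∀ z ∈ K, ∀ w ∈ K, inner ℝ (f z - f w) (z - w) ≤ 0

/-- `e` is an equilibrium of the field `f` projected to `K`, that is, a zero of
`z ↦ f(z) - P_{N_K(z)}(f(z))` in `K`. -/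
structure IsEquilibrium (f : E → E) (K : Set E) (e : E) : Prop where
  mem : e ∈ K
  mem_normalCone : f e ∈ normalCone K e

/-- The Carathéodory solutions in `K` of `ż = f(z) - P_{N_K(z)}(f(z))` on `[0, ∞)`, extended
arbitrarily to negative times. For `f = gradField φ` this is `IsSubgradTrajectory φ K`. -/
structure IsProjTrajectory (f : E → E) (K : Set E) (z : ℝ → E) : Prop where
  mem : ∀ t, 0 ≤ t → z t ∈ K
  absolutelyContinuous : ∀ T, 0 ≤ T → AbsolutelyContinuousOnInterval z 0 T
  hasDerivAt : ∀ᵐ t : ℝ, 0 < t →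
    HasDerivAt z (f (z t) - proj (normalCone K (z t)) (f (z t))) t

variable {f : E → E} {K : Set E} {e : E} {z w : ℝ → E}

theorem DissipativeOn.mono {L : Set E} (hd : DissipativeOn f L) (h : K ⊆ L) :
    DissipativeOn f K :=
  fun z hz w hw => hd z (h hz) w (h hw)

theorem IsEquilibrium.isProjTrajectory_const (he : IsEquilibrium f K e) :
    IsProjTrajectory f K fun _ => e := by
  refine ⟨fun _ _ => he.mem, fun T _ => ?_, .of_forall fun t _ => ?_⟩
  · exact ContDiffOn.absolutelyContinuousOnInterval contDiffOn_const
  · rw [proj_eq_self he.mem_normalCone, sub_self]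
    exact hasDerivAt_const t e

namespace IsProjTrajectory

theorem eventually_mem (hz : IsProjTrajectory f K z) {t : ℝ} (ht : 0 < t) :
    ∀ᶠ s in 𝓝 t, z s ∈ K := by
  filter_upwards [Ioi_mem_nhds ht] with s hs using hz.mem s (mem_Ioi.1 hs).le

theorem absolutelyContinuousOnInterval (hz : IsProjTrajectory f K z) {s t : ℝ} (hs : 0 ≤ s)
    (hst : s ≤ t) : AbsolutelyContinuousOnInterval z s t :=
  (hz.absolutelyContinuous t (hs.trans hst)).mono (by
    rw [uIcc_of_le hst, uIcc_of_le (hs.trans hst)]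
    exact Icc_subset_Icc_left hs)

theorem continuousOn (hz : IsProjTrajectory f K z) : ContinuousOn z (Ici 0) := by
  intro t ht
  have hle : t ≤ t + 1 := by linarith
  have hcont := (hz.absolutelyContinuous (t + 1) (ht.trans hle)).continuousOn
  rw [uIcc_of_le (ht.trans hle)] at hcont
  refine (hcont t ⟨ht, hle⟩).mono_of_mem_nhdsWithin ?_
  filter_upwards [self_mem_nhdsWithin, mem_nhdsWithin_of_mem_nhds (Iio_mem_nhds (lt_add_one t))]
    with s hs hst using ⟨hs, le_of_lt hst⟩

theorem congr (hz : IsProjTrajectory f K z) (h : EqOn w z (Ici 0)) : IsProjTrajectory f K w := by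
  refine ⟨fun t ht => h ht ▸ hz.mem t ht, fun T hT => ?_, ?_⟩
  · have hmem : Icc 0 T ⊆ Ici (0 : ℝ) := Icc_subset_Ici_self
    refine (hz.absolutelyContinuous T hT).congr' ?_
    filter_upwards [mem_inf_of_right (mem_principal_self _)] with P hP
    refine Finset.sum_congr rfl fun i hi => ?_
    have hi := hP.1 i hi
    rw [uIcc_of_le hT] at hi
    rw [h (hmem hi.1), h (hmem hi.2)]
  · filter_upwards [hz.hasDerivAt] with t hderiv ht
    rw [h ht.le]
    exact (hderiv ht).congr_of_eventuallyEq (h.eventuallyEq_of_mem (Ici_mem_nhds ht))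

theorem comp_const_add (hz : IsProjTrajectory f K z) {a : ℝ} (ha : 0 ≤ a) :
    IsProjTrajectory f K fun t => z (a + t) := by
  refine ⟨fun t ht => hz.mem _ (add_nonneg ha ht), fun T hT => ?_, ?_⟩
  · exact absolutelyContinuousOnInterval_comp_const_add
      (hz.absolutelyContinuousOnInterval (by linarith) (by linarith))
  · have hae := (measurePreserving_add_left volume a).quasiMeasurePreserving.ae hz.hasDerivAt
    filter_upwards [hae] with t hderiv ht
    exact (hderiv (by linarith)).comp_const_add a t

section Dissipative

variable [CompleteSpace E]

theorem antitoneOn_dist (hd : DissipativeOn f K) (hz : IsProjTrajectory f K z)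
    (hw : IsProjTrajectory f K w) : AntitoneOn (fun t => dist (z t) (w t)) (Ici 0) := by
  intro s hs t _ hst
  simp only [dist_eq_norm]
  refine le_of_sq_le_sq ?_ (norm_nonneg _)
  refine le_of_ae_hasDerivAt_nonpos (g := fun r => ‖z r - w r‖ ^ 2) hst
    (absolutelyContinuousOnInterval_norm_sq ((hz.absolutelyContinuousOnInterval hs hst).fun_sub
      (hw.absolutelyContinuousOnInterval hs hst))) ?_
  filter_upwards [hz.hasDerivAt, hw.hasDerivAt] with r hzr hwr hr
  have hr0 : 0 < r := lt_of_le_of_lt hs hr.1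
  refine ⟨_, ?_, ((hzr hr0).fun_sub (hwr hr0)).norm_sq⟩
  have hf := hd _ (hz.mem r hr0.le) _ (hw.mem r hr0.le)
  have hN := inner_sub_nonneg_of_mem_normalCone (hz.mem r hr0.le) (hw.mem r hr0.le)
    (proj_normalCone_mem K (z r) (f (z r))) (proj_normalCone_mem K (w r) (f (w r)))
  rw [real_inner_comm, sub_sub_sub_comm, inner_sub_left]
  linarith

theorem eqOn_of_eq (hd : DissipativeOn f K) (hz : IsProjTrajectory f K z)
    (hw : IsProjTrajectory f K w) (h : z 0 = w 0) : EqOn z w (Ici 0) := fun t ht => by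
  have hle := hz.antitoneOn_dist hd hw self_mem_Ici ht ht
  simp only [h, dist_self] at hle
  exact dist_le_zero.1 hle

theorem dist_le (hd : DissipativeOn f K) (he : IsEquilibrium f K e)
    (hz : IsProjTrajectory f K z) {t : ℝ} (ht : 0 ≤ t) : dist (z t) e ≤ dist (z 0) e :=
  hz.antitoneOn_dist hd he.isProjTrajectory_const self_mem_Ici ht ht

theorem isBounded_image (hd : DissipativeOn f K) (he : IsEquilibrium f K e)
    (hz : IsProjTrajectory f K z) : Bornology.IsBounded (z '' Ici 0) :=
  Metric.isBounded_closedBall.subset (image_subset_iff.2 fun _ ht => hz.dist_le hd he ht)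

theorem lipschitzOnWith (hz : IsProjTrajectory f K z) {C : ℝ≥0}
    (hC : ∀ t, 0 ≤ t → ‖f (z t)‖ ≤ C) : LipschitzOnWith C z (Ici 0) := by
  refine LipschitzOnWith.of_dist_le_mul fun s hs t ht => ?_
  wlog hst : s ≤ t generalizing s t
  · rw [dist_comm, dist_comm s]
    exact this t ht s hs (le_of_not_ge hst)
  rw [dist_comm s, Real.dist_eq, abs_of_nonneg (sub_nonneg.2 hst)]
  refine dist_le_of_ae_hasDerivAt hst (hz.absolutelyContinuousOnInterval hs hst) ?_
  filter_upwards [hz.hasDerivAt] with r hr hmem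
  exact ⟨_, (norm_sub_proj_normalCone_le K _ _).trans (hC r (hs.trans hmem.1.le)),
    hr (lt_of_le_of_lt hs hmem.1)⟩

end Dissipative

end IsProjTrajectory

end ProjTrajectory

section EvolutionVariationalInequality

theorem hasDerivAt_integral_of_continuousOn_Ici {F : Type*} [NormedAddCommGroup F]
    [NormedSpace ℝ F] [CompleteSpace F] {g : ℝ → F} (hg : ContinuousOn g (Ici 0)) {a t : ℝ}
    (ha : 0 ≤ a) (ht : 0 < t) : HasDerivAt (fun x => ∫ r in a..x, g r) (g t) t := by
  refine intervalIntegral.integral_hasDerivAt_right ?_ ?_ (hg.continuousAt (Ici_mem_nhds ht))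
  · exact (hg.mono fun r hr => (le_inf ha ht.le).trans hr.1).intervalIntegrable
  · exact (hg.mono Ioi_subset_Ici_self).stronglyMeasurableAtFilter isOpen_Ioi t ht

variable {E : Type*} [NormedAddCommGroup E] [InnerProductSpace ℝ E]

/-- The evolution variational inequality of the field `f` projected to `K`, in integrated form.
Among Lipschitz curves in `K` it characterizes the trajectories, and unlike the differential
equation it passes to pointwise limits. -/
def EvolutionVariationalInequality (f : E → E) (K : Set E) (u : ℝ → E) : Prop :=
  ∀ q ∈ K, ∀ s t, 0 ≤ s → s ≤ t →
    ‖u t - q‖ ^ 2 - ‖u s - q‖ ^ 2 ≤ ∫ r in s..t, 2 * inner ℝ (f (u r)) (u r - q)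

variable {f : E → E} {K : Set E} {u : ℝ → E}

theorem continuousOn_two_mul_inner_sub (hf : Continuous f) {I : Set ℝ} (hu : ContinuousOn u I)
    (q : E) : ContinuousOn (fun r => 2 * inner ℝ (f (u r)) (u r - q)) I :=
  continuousOn_const.mul ((hf.comp_continuousOn hu).inner (hu.sub continuousOn_const))

theorem IsProjTrajectory.evolutionVariationalInequality [CompleteSpace E] (hf : Continuous f)
    (hu : IsProjTrajectory f K u) : EvolutionVariationalInequality f K u := by
  intro q hq s t hs hst
  have hcont := continuousOn_two_mul_inner_sub hf hu.continuousOn q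
  have hsub : uIcc s t ⊆ Ici 0 := by
    rw [uIcc_of_le hst]
    exact fun r hr => hs.trans hr.1
  have hnorm : AbsolutelyContinuousOnInterval (fun r => ‖u r - q‖ ^ 2) s t :=
    absolutelyContinuousOnInterval_norm_sq ((hu.absolutelyContinuousOnInterval hs hst).fun_sub
      (ContDiffOn.absolutelyContinuousOnInterval contDiffOn_const))
  have hintegral := (hcont.mono hsub).intervalIntegrable
    |>.absolutelyContinuousOnInterval_intervalIntegral (c := s) left_mem_uIcc
  have hle := le_of_ae_hasDerivAt_nonpos hst (hnorm.fun_sub hintegral) (by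
    filter_upwards [hu.hasDerivAt] with r hderiv hr
    have hr0 : 0 < r := hs.trans_lt hr.1
    refine ⟨_, ?_, ((hderiv hr0).sub_const q).norm_sq.fun_sub
      (hasDerivAt_integral_of_continuousOn_Ici hcont hs hr0)⟩
    have hN := proj_normalCone_mem K (u r) (f (u r)) q hq
    rw [← neg_sub (u r) q, inner_neg_right] at hN
    rw [real_inner_comm, inner_sub_left]
    linarith)
  simp only [intervalIntegral.integral_same, sub_zero] at hle
  linarith

theorem EvolutionVariationalInequality.sub_mem_normalCone (hf : Continuous f)
    (hu : EvolutionVariationalInequality f K u) (hcont : ContinuousOn u (Ici 0)) {t : ℝ}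
    (ht : 0 < t) {v : E} (hv : HasDerivAt u v t) : f (u t) - v ∈ normalCone K (u t) := by
  intro q hq
  have hslope := ((hv.sub_const q).norm_sq.fun_sub (hasDerivAt_integral_of_continuousOn_Ici
    (continuousOn_two_mul_inner_sub hf hcont q) ht.le ht)).tendsto_slope_zero_right
  have hle : 2 * inner ℝ (u t - q) v - 2 * inner ℝ (f (u t)) (u t - q) ≤ 0 := by
    refine le_of_tendsto hslope ?_
    filter_upwards [self_mem_nhdsWithin] with h (hh : 0 < h)
    have hvar := hu q hq t (t + h) ht.le (by linarith)
    simp only [intervalIntegral.integral_same, sub_zero, smul_eq_mul]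
    exact mul_nonpos_of_nonneg_of_nonpos (inv_nonneg.2 hh.le) (by linarith)
  rw [real_inner_comm] at hle
  rw [← neg_sub (u t) q, inner_neg_right, inner_sub_left]
  linarith

section FiniteDimensional

variable [FiniteDimensional ℝ E]

theorem EvolutionVariationalInequality.isProjTrajectory (hf : Continuous f)
    (hu : EvolutionVariationalInequality f K u) (hmem : ∀ t, 0 ≤ t → u t ∈ K) {C : ℝ≥0}
    (hlip : LipschitzOnWith C u (Ici 0)) : IsProjTrajectory f K u := by
  refine ⟨hmem, fun T hT => ?_, ?_⟩
  · refine (hlip.mono ?_).absolutelyContinuousOnInterval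
    rw [uIcc_of_le hT]
    exact Icc_subset_Ici_self
  · filter_upwards [hlip.ae_differentiableWithinAt_of_mem_real] with t hdiff ht
    have hderiv := ((hdiff ht.le).differentiableAt (Ici_mem_nhds ht)).hasDerivAt
    have hmem : ∀ᶠ s in 𝓝 t, u s ∈ K := by
      filter_upwards [Ioi_mem_nhds ht] with s hs using hmem s (mem_Ioi.1 hs).le
    rwa [← eq_sub_proj_of_hasDerivAt hderiv hmem
      (hu.sub_mem_normalCone hf hlip.continuousOn ht hderiv)]

theorem tendsto_integral_two_mul_inner_sub (hf : Continuous f) {z : ℕ → ℝ → E} {R s t : ℝ}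
    (hst : s ≤ t) (hz : ∀ k, ContinuousOn (z k) (Ioc s t))
    (hR : ∀ k, ∀ r ∈ Ioc s t, ‖z k r‖ ≤ R)
    (hu : ∀ r ∈ Ioc s t, Tendsto (fun k => z k r) atTop (𝓝 (u r))) (q : E) :
    Tendsto (fun k => ∫ r in s..t, 2 * inner ℝ (f (z k r)) (z k r - q)) atTop
      (𝓝 (∫ r in s..t, 2 * inner ℝ (f (u r)) (u r - q))) := by
  have hcont : Continuous fun p => 2 * inner ℝ (f p) (p - q) := by fun_prop
  obtain ⟨C, hC⟩ :=
    (isCompact_closedBall (0 : E) R).exists_bound_of_continuousOn hcont.continuousOn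
  refine intervalIntegral.tendsto_integral_filter_of_dominated_convergence (fun _ => C)
    (.of_forall fun k => ?_) (.of_forall fun k => .of_forall fun r hr => ?_)
    intervalIntegrable_const (.of_forall fun r hr => ?_) <;> rw [uIoc_of_le hst] at *
  · exact (continuousOn_two_mul_inner_sub hf (hz k) q).aestronglyMeasurable measurableSet_Ioc
  · exact hC _ (mem_closedBall_zero_iff.2 (hR k r hr))
  · exact (hcont.tendsto _).comp (hu r hr)

theorem isProjTrajectory_of_tendsto (hf : Continuous f) (hK : IsClosed K) {z : ℕ → ℝ → E} {R : ℝ}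
    (hz : ∀ k, IsProjTrajectory f K (z k)) (hR : ∀ k t, 0 ≤ t → ‖z k t‖ ≤ R)
    (hu : ∀ t, 0 ≤ t → Tendsto (fun k => z k t) atTop (𝓝 (u t))) : IsProjTrajectory f K u := by
  obtain ⟨C, hC⟩ := (isCompact_closedBall (0 : E) R).exists_bound_of_continuousOn hf.continuousOn
  have hlip : LipschitzOnWith C.toNNReal u (Ici 0) := by
    refine LipschitzOnWith.of_dist_le_mul fun s hs t ht => ?_
    refine le_of_tendsto ((hu s hs).dist (hu t ht)) (.of_forall fun k => ?_)
    refine ((hz k).lipschitzOnWith fun r hr => ?_).dist_le_mul s hs t ht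
    exact (hC _ (mem_closedBall_zero_iff.2 (hR k r hr))).trans (Real.le_coe_toNNReal C)
  refine EvolutionVariationalInequality.isProjTrajectory hf (fun q hq s t hs hst => ?_)
    (fun t ht => hK.mem_of_tendsto (hu t ht) (.of_forall fun k => (hz k).mem t ht)) hlip
  have hsub : Ioc s t ⊆ Ici 0 := fun r hr => hs.trans hr.1.le
  refine le_of_tendsto_of_tendsto ((((hu t (hs.trans hst)).sub_const q).norm.pow 2).sub
      (((hu s hs).sub_const q).norm.pow 2))
    (tendsto_integral_two_mul_inner_sub hf hst (fun k => (hz k).continuousOn.mono hsub)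
      (fun k r hr => hR k r (hsub hr)) (fun r hr => hu r (hsub hr)) q)
    (.of_forall fun k => (hz k).evolutionVariationalInequality hf q hq s t hs hst)

theorem exists_isProjTrajectory_of_tendsto (hf : Continuous f) (hK : IsClosed K)
    (hd : DissipativeOn f K) {e : E} (he : IsEquilibrium f K e) {z : ℕ → ℝ → E}
    (hz : ∀ k, IsProjTrajectory f K (z k)) {p : E}
    (hp : Tendsto (fun k => z k 0) atTop (𝓝 p)) :
    ∃ u, IsProjTrajectory f K u ∧ u 0 = p ∧
      ∀ t, 0 ≤ t → Tendsto (fun k => z k t) atTop (𝓝 (u t)) := by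
  have hlim : ∀ t, 0 ≤ t → ∃ l, Tendsto (fun k => z k t) atTop (𝓝 l) := fun t ht => by
    refine cauchySeq_tendsto_of_complete (Metric.cauchySeq_iff.2 fun ε hε => ?_)
    obtain ⟨N, hN⟩ := Metric.cauchySeq_iff.1 hp.cauchySeq ε hε
    exact ⟨N, fun i hi j hj =>
      ((hz i).antitoneOn_dist hd (hz j) self_mem_Ici ht ht).trans_lt (hN i hi j hj)⟩
  choose! u hu using hlim
  obtain ⟨R, hR⟩ := (Metric.isBounded_range_of_tendsto _ hp).subset_closedBall e
  refine ⟨u, isProjTrajectory_of_tendsto (R := ‖e‖ + R) hf hK hz (fun k t ht => ?_) hu,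
    tendsto_nhds_unique (hu 0 le_rfl) hp, hu⟩
  exact norm_le_of_mem_closedBall (((hz k).dist_le hd he ht).trans (hR (mem_range_self k)))

end FiniteDimensional

end EvolutionVariationalInequality

section Recurrence

theorem mapClusterPt_of_dist_le {X Y ι : Type*} [PseudoMetricSpace X] [PseudoMetricSpace Y]
    {l : Filter ι} {u : ι → X} {g : ι → Y} {x : X} {y : Y} {c : ℝ} (hu : MapClusterPt x l u)
    (h : ∀ᶠ i in l, dist (g i) y ≤ c * dist (u i) x) : MapClusterPt y l g := by
  rw [mapClusterPt_iff_ultrafilter] at hu ⊢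
  obtain ⟨U, hUl, hU⟩ := hu
  refine ⟨U, hUl, tendsto_iff_dist_tendsto_zero.2 ?_⟩
  refine squeeze_zero' (.of_forall fun _ => dist_nonneg) (hUl h) ?_
  simpa only [mul_zero] using (tendsto_iff_dist_tendsto_zero.1 hU).const_mul c

theorem exists_seq_ge_tendsto_of_mapClusterPt {X : Type*} [TopologicalSpace X]
    [FirstCountableTopology X] {w : ℝ → X} {p : X} (hp : MapClusterPt p atTop w) (a : ℝ) :
    ∃ τ : ℕ → ℝ, (∀ k, a ≤ τ k) ∧ Tendsto τ atTop atTop ∧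
      Tendsto (fun k => w (τ k)) atTop (𝓝 p) := by
  obtain ⟨τ, hlim, hτ⟩ := hp.exists_seq_tendsto
  refine ⟨fun k => max (τ k) a, fun k => le_max_right _ _,
    tendsto_atTop_mono (fun k => le_max_left _ _) hτ, hlim.congr' ?_⟩
  filter_upwards [hτ.eventually_ge_atTop a] with k hk
  rw [max_eq_left hk, Function.comp_apply]

theorem eq_of_antitoneOn_of_mapClusterPt {g : ℝ → ℝ} (hg : AntitoneOn g (Ici 0))
    (hcluster : MapClusterPt (g 0) atTop g) {t : ℝ} (ht : 0 ≤ t) : g t = g 0 := by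
  refine le_antisymm (hg self_mem_Ici ht ht) ?_
  have hsub : closure (g '' Ici t) ⊆ Iic (g t) := closure_minimal
    (image_subset_iff.2 fun s hs => hg ht (mem_Ici.2 (ht.trans hs)) hs) isClosed_Iic
  exact hsub (mapClusterPt_atTop_iff_forall_mem_closure.1 hcluster t)

theorem mapClusterPt_of_isometric_shift {X : Type*} [PseudoMetricSpace X] [ProperSpace X]
    {w : ℝ → X} (hw : Bornology.IsBounded (w '' Ici 0))
    (hshift : ∀ r s, 0 ≤ r → 0 ≤ s → dist (w (r + s)) (w r) = dist (w s) (w 0)) :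
    MapClusterPt (w 0) atTop w := by
  obtain ⟨p, -, hp⟩ := hw.isCompact_closure.exists_mapClusterPt (f := atTop) (u := w)
    (tendsto_principal.2 ((eventually_ge_atTop 0).mono fun t ht =>
      subset_closure (mem_image_of_mem w ht)))
  refine Metric.nhds_basis_ball.mapClusterPt_iff_frequently.2 fun ε hε => ?_
  have hfreq := Metric.nhds_basis_ball.mapClusterPt_iff_frequently.1 hp (ε / 2) (half_pos hε)
  obtain ⟨r, hr, hr0⟩ := (hfreq.and_eventually (eventually_ge_atTop 0)).exists
  refine frequently_atTop.2 fun T => ?_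
  obtain ⟨t, ht, htT⟩ := (hfreq.and_eventually (eventually_ge_atTop (r + max T 0))).exists
  refine ⟨t - r, by linarith [le_max_left T 0], ?_⟩
  have hs := hshift r (t - r) hr0 (by linarith [le_max_right T 0])
  rw [add_sub_cancel] at hs
  rw [Metric.mem_ball, ← hs]
  exact (dist_triangle_right _ _ p).trans_lt (add_halves ε ▸ add_lt_add ht hr)

variable {E : Type*} [NormedAddCommGroup E] [InnerProductSpace ℝ E]

/-- The union of the `ω`-limit sets of the trajectories of `f` projected to `K`. For
`f = gradField φ` this is `omegaLimitSet φ K`. -/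
def projOmega (f : E → E) (K : Set E) : Set E :=
  {p | ∃ z, IsProjTrajectory f K z ∧ MapClusterPt p atTop z}

/-- The trajectories of `f` projected to `K` that lie in their own `ω`-limit sets. -/
structure IsRecurrentTrajectory (f : E → E) (K : Set E) (u : ℝ → E) : Prop
    extends IsProjTrajectory f K u where
  mapClusterPt : MapClusterPt (u 0) atTop u

variable {f : E → E} {K : Set E} {e : E} {u v : ℝ → E}

theorem IsEquilibrium.isRecurrentTrajectory_const (he : IsEquilibrium f K e) :
    IsRecurrentTrajectory f K fun _ => e :=
  ⟨he.isProjTrajectory_const, tendsto_const_nhds.mapClusterPt⟩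

theorem isRecurrentTrajectory_of_isometric_shift [FiniteDimensional ℝ E] (hd : DissipativeOn f K)
    (he : IsEquilibrium f K e) (hu : IsProjTrajectory f K u)
    (hshift : ∀ r s, 0 ≤ r → 0 ≤ s → dist (u (r + s)) (u r) = dist (u s) (u 0)) :
    IsRecurrentTrajectory f K u :=
  ⟨hu, mapClusterPt_of_isometric_shift (hu.isBounded_image hd he) hshift⟩

namespace IsRecurrentTrajectory

theorem mem_projOmega (hu : IsRecurrentTrajectory f K u) : u 0 ∈ projOmega f K :=
  ⟨u, hu.toIsProjTrajectory, hu.mapClusterPt⟩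

theorem congr (hu : IsRecurrentTrajectory f K u) (h : EqOn v u (Ici 0)) :
    IsRecurrentTrajectory f K v := by
  refine ⟨hu.toIsProjTrajectory.congr h, ?_⟩
  rw [h self_mem_Ici, MapClusterPt, map_congr ((eventually_ge_atTop 0).mono h)]
  exact hu.mapClusterPt

section CompleteSpace

variable [CompleteSpace E]

theorem dist_add_right (hd : DissipativeOn f K) (hu : IsRecurrentTrajectory f K u) {r s : ℝ}
    (hr : 0 ≤ r) (hs : 0 ≤ s) : dist (u (r + s)) (u r) = dist (u s) (u 0) := by
  have hshift := fun a (ha : 0 ≤ a) => hu.toIsProjTrajectory.comp_const_add ha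
  have hanti := (hshift s hs).antitoneOn_dist hd hu.toIsProjTrajectory
  suffices MapClusterPt (dist (u (s + 0)) (u 0)) atTop fun r => dist (u (s + r)) (u r) by
    simpa only [add_comm s, zero_add] using eq_of_antitoneOn_of_mapClusterPt hanti this hr
  refine mapClusterPt_of_dist_le (c := 2) hu.mapClusterPt ?_
  filter_upwards [eventually_ge_atTop 0] with r hr
  refine (dist_dist_dist_le _ _ _ _).trans ?_
  have hle := (hshift r hr).antitoneOn_dist hd hu.toIsProjTrajectory self_mem_Ici hs hs
  simp only [add_zero, zero_add, add_comm r] at hle ⊢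
  linarith

theorem comp_const_add (hd : DissipativeOn f K) (hu : IsRecurrentTrajectory f K u) {a : ℝ}
    (ha : 0 ≤ a) : IsRecurrentTrajectory f K fun t => u (a + t) := by
  refine ⟨hu.toIsProjTrajectory.comp_const_add ha,
    mapClusterPt_of_dist_le (c := 1) hu.mapClusterPt ?_⟩
  filter_upwards [eventually_ge_atTop 0] with t ht
  rw [one_mul, add_zero, hu.dist_add_right hd ha ht]

end CompleteSpace

variable [FiniteDimensional ℝ E]

theorem mapClusterPt_prodMk (hd : DissipativeOn f K) (he : IsEquilibrium f K e)
    (hu : IsRecurrentTrajectory f K u) (hv : IsRecurrentTrajectory f K v) :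
    MapClusterPt (u 0, v 0) atTop fun t => (u t, v t) := by
  refine mapClusterPt_of_isometric_shift (w := fun t => (u t, v t)) ?_ fun r s hr hs => ?_
  · refine ((hu.isBounded_image hd he).prod (hv.isBounded_image hd he)).subset ?_
    exact image_subset_iff.2 fun t ht => ⟨mem_image_of_mem u ht, mem_image_of_mem v ht⟩
  · simp only [Prod.dist_eq, hu.dist_add_right hd hr hs, hv.dist_add_right hd hr hs]

theorem dist_eq (hd : DissipativeOn f K) (he : IsEquilibrium f K e)
    (hu : IsRecurrentTrajectory f K u) (hv : IsRecurrentTrajectory f K v) {t : ℝ} (ht : 0 ≤ t) :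
    dist (u t) (v t) = dist (u 0) (v 0) :=
  eq_of_antitoneOn_of_mapClusterPt (hu.antitoneOn_dist hd hv.toIsProjTrajectory)
    ((hu.mapClusterPt_prodMk hd he hv).continuousAt_comp continuous_dist.continuousAt) ht

end IsRecurrentTrajectory

variable [FiniteDimensional ℝ E]

theorem exists_isRecurrentTrajectory_of_tendsto (hf : Continuous f) (hK : IsClosed K)
    (hd : DissipativeOn f K) (he : IsEquilibrium f K e) {z : ℕ → ℝ → E}
    (hz : ∀ k, IsRecurrentTrajectory f K (z k)) {p : E}
    (hp : Tendsto (fun k => z k 0) atTop (𝓝 p)) :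
    ∃ u, IsRecurrentTrajectory f K u ∧ u 0 = p ∧
      ∀ t, 0 ≤ t → Tendsto (fun k => z k t) atTop (𝓝 (u t)) := by
  obtain ⟨u, hu, hu0, hlim⟩ :=
    exists_isProjTrajectory_of_tendsto hf hK hd he (fun k => (hz k).toIsProjTrajectory) hp
  refine ⟨u, isRecurrentTrajectory_of_isometric_shift hd he hu fun r s hr hs => ?_, hu0, hlim⟩
  refine tendsto_nhds_unique ((hlim _ (add_nonneg hr hs)).dist (hlim r hr)) ?_
  simp only [(hz _).dist_add_right hd hr hs]
  exact (hlim s hs).dist (hlim 0 le_rfl)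

theorem exists_isRecurrentTrajectory_of_mem_projOmega (hf : Continuous f) (hK : IsClosed K)
    (hd : DissipativeOn f K) (he : IsEquilibrium f K e) {p : E} (hp : p ∈ projOmega f K) :
    ∃ u, IsRecurrentTrajectory f K u ∧ u 0 = p := by
  obtain ⟨z, hz, hcluster⟩ := hp
  obtain ⟨τ, hτ0, hτ, hlim⟩ := exists_seq_ge_tendsto_of_mapClusterPt hcluster 0
  have hshift := fun k => hz.comp_const_add (hτ0 k)
  obtain ⟨u, hu, rfl, -⟩ := exists_isProjTrajectory_of_tendsto hf hK hd he hshift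
    (by simpa only [add_zero] using hlim)
  refine ⟨u, ⟨hu, Metric.nhds_basis_ball.mapClusterPt_iff_frequently.2 fun ε hε => ?_⟩, rfl⟩
  have hnear := Metric.tendsto_nhds.1 hlim (ε / 2) (half_pos hε)
  obtain ⟨k, hk⟩ := hnear.exists
  refine (tendsto_atTop_add_const_right atTop (-τ k) hτ).frequently (Eventually.frequently ?_)
  filter_upwards [hnear, hτ.eventually_ge_atTop (τ k)] with l hl hkl
  have hle := hu.antitoneOn_dist hd (hshift k) self_mem_Ici (sub_nonneg.2 hkl) (sub_nonneg.2 hkl)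
  simp only [add_sub_cancel, add_zero] at hle
  rw [dist_comm (u 0)] at hle
  rw [← sub_eq_add_neg, Metric.mem_ball]
  linarith [dist_triangle (u (τ l - τ k)) (z (τ l)) (u 0)]

theorem IsRecurrentTrajectory.exists_backward (hf : Continuous f) (hK : IsClosed K)
    (hd : DissipativeOn f K) (he : IsEquilibrium f K e) (hu : IsRecurrentTrajectory f K u) {a : ℝ}
    (ha : 0 ≤ a) : ∃ v, IsRecurrentTrajectory f K v ∧ v a = u 0 := by
  obtain ⟨τ, hτ, -, hlim⟩ := exists_seq_ge_tendsto_of_mapClusterPt hu.mapClusterPt a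
  have hz := fun k => hu.comp_const_add hd (sub_nonneg.2 (hτ k))
  have hlim' : Tendsto (fun k => u (τ k - a + a)) atTop (𝓝 (u 0)) := by
    simpa only [sub_add_cancel] using hlim
  have hcauchy : CauchySeq fun k => u (τ k - a + 0) := by
    refine Metric.cauchySeq_iff.2 fun ε hε => ?_
    obtain ⟨N, hN⟩ := Metric.cauchySeq_iff.1 hlim'.cauchySeq ε hε
    exact ⟨N, fun i hi j hj => ((hz i).dist_eq hd he (hz j) ha).ge.trans_lt (hN i hi j hj)⟩
  obtain ⟨p, hp⟩ := cauchySeq_tendsto_of_complete hcauchy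
  obtain ⟨v, hv, rfl, hvlim⟩ := exists_isRecurrentTrajectory_of_tendsto hf hK hd he hz hp
  exact ⟨v, hv, tendsto_nhds_unique (hvlim a ha) hlim'⟩

theorem isClosed_projOmega (hf : Continuous f) (hK : IsClosed K) (hd : DissipativeOn f K)
    (he : IsEquilibrium f K e) : IsClosed (projOmega f K) := by
  refine IsSeqClosed.isClosed fun x p hx hlim => ?_
  choose z hz hz0 using fun k =>
    exists_isRecurrentTrajectory_of_mem_projOmega hf hK hd he (hx k)
  obtain ⟨u, hu, rfl, -⟩ := exists_isRecurrentTrajectory_of_tendsto hf hK hd he hz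
    (by simpa only [hz0] using hlim)
  exact hu.mem_projOmega

end Recurrence

section ConvexCombination

variable {E : Type*} [NormedAddCommGroup E] [InnerProductSpace ℝ E]
variable {f : E → E} {K : Set E} {e : E} {u v : ℝ → E}

theorem sub_mem_normalCone_of_forall_inner_nonpos (hf : Continuous f) (hK : Convex ℝ K) {z v : E}
    (hz : z ∈ K) (h : ∀ p ∈ K, inner ℝ (f p - v) (p - z) ≤ 0) : f z - v ∈ normalCone K z := by
  intro q hq
  have hcont : Continuous fun ε : ℝ => inner ℝ (f (z + ε • (q - z)) - v) (q - z) := by fun_prop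
  have hlim := (hcont.tendsto 0).mono_left (nhdsWithin_le_nhds (s := Ioi 0))
  simp only [zero_smul, add_zero] at hlim
  refine le_of_tendsto hlim ?_
  filter_upwards [Ioc_mem_nhdsGT zero_lt_one] with ε hε
  have hp := h _ (hK.add_smul_sub_mem hz hq ⟨hε.1.le, hε.2⟩)
  rw [add_sub_cancel_left, inner_smul_right] at hp
  exact nonpos_of_mul_nonpos_right hp hε.1

theorem DissipativeOn.sub_mem_normalCone_of_inner_eq_zero (hf : Continuous f) (hK : Convex ℝ K)
    (hd : DissipativeOn f K) {z w : E} (hz : z ∈ K) (hw : w ∈ K)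
    (h0 : inner ℝ (f z - f w) (z - w) = 0) {a b : ℝ} (ha : 0 ≤ a) (hb : 0 ≤ b) (hab : a + b = 1) :
    f (a • z + b • w) - (a • f z + b • f w) ∈ normalCone K (a • z + b • w) := by
  refine sub_mem_normalCone_of_forall_inner_nonpos hf hK (hK hz hw ha hb hab) fun p hp => ?_
  have hz' := mul_nonpos_of_nonneg_of_nonpos ha (hd z hz p hp)
  have hw' := mul_nonpos_of_nonneg_of_nonpos hb (hd w hw p hp)
  obtain rfl : b = 1 - a := by linarith
  have hsum : inner ℝ (f p - (a • f z + (1 - a) • f w)) (p - (a • z + (1 - a) • w)) +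
      a * (1 - a) * inner ℝ (f z - f w) (z - w) =
      a * inner ℝ (f z - f p) (z - p) + (1 - a) * inner ℝ (f w - f p) (w - p) := by
    simp only [inner_sub_left, inner_sub_right, inner_add_left, inner_add_right,
      inner_smul_right, real_inner_smul_left]
    ring
  rw [h0, mul_zero, add_zero] at hsum
  linarith

theorem DissipativeOn.inner_eq_zero_of_dist_eq (hd : DissipativeOn f K) {t : ℝ} (hut : u t ∈ K)
    (hvt : v t ∈ K) {m n : E} (hm : m ∈ normalCone K (u t)) (hn : n ∈ normalCone K (v t))
    (hu : HasDerivAt u (f (u t) - m) t) (hv : HasDerivAt v (f (v t) - n) t)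
    (hdist : ∀ᶠ s in 𝓝 t, dist (u s) (v s) = dist (u t) (v t)) :
    inner ℝ (f (u t) - f (v t)) (u t - v t) = 0 ∧
      inner ℝ m (u t - v t) = 0 ∧ inner ℝ n (u t - v t) = 0 := by
  have hconst : HasDerivAt (fun s => ‖u s - v s‖ ^ 2) 0 t := by
    refine (hasDerivAt_const t (‖u t - v t‖ ^ 2)).congr_of_eventuallyEq ?_
    filter_upwards [hdist] with s hs
    rw [← dist_eq_norm, hs, dist_eq_norm]
  have hzero := (hu.fun_sub hv).norm_sq.unique hconst
  have hf := hd _ hut _ hvt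
  have hm := hm _ hvt
  have hn := hn _ hut
  rw [← neg_sub (u t), inner_neg_right] at hm
  rw [real_inner_comm, sub_sub_sub_comm, inner_sub_left, inner_sub_left m] at hzero
  refine ⟨?_, ?_, ?_⟩ <;> linarith

theorem IsProjTrajectory.convexCombination [CompleteSpace E] (hf : Continuous f)
    (hK : Convex ℝ K) (hd : DissipativeOn f K) (hu : IsProjTrajectory f K u)
    (hv : IsProjTrajectory f K v) (hdist : ∀ t, 0 ≤ t → dist (u t) (v t) = dist (u 0) (v 0))
    {a b : ℝ} (ha : 0 ≤ a) (hb : 0 ≤ b) (hab : a + b = 1) :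
    IsProjTrajectory f K fun t => a • u t + b • v t := by
  have hmem : ∀ t, 0 ≤ t → a • u t + b • v t ∈ K := fun t ht =>
    hK (hu.mem t ht) (hv.mem t ht) ha hb hab
  refine ⟨hmem, fun T hT => ((hu.absolutelyContinuous T hT).const_smul a).fun_add
    ((hv.absolutelyContinuous T hT).const_smul b), ?_⟩
  filter_upwards [hu.hasDerivAt, hv.hasDerivAt] with t hut hvt ht
  have hpos : ∀ᶠ s in 𝓝 t, 0 ≤ s := Ici_mem_nhds ht
  have hm := proj_normalCone_mem K (u t) (f (u t))
  have hn := proj_normalCone_mem K (v t) (f (v t))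
  obtain ⟨hf0, hm0, hn0⟩ := hd.inner_eq_zero_of_dist_eq (hu.mem t ht.le) (hv.mem t ht.le) hm hn
    (hut ht) (hvt ht) (hpos.mono fun s hs => (hdist s hs).trans (hdist t ht.le).symm)
  have hm' := mem_normalCone_of_inner_eq_zero (z' := a • u t + b • v t) hm (by
    rw [show a • u t + b • v t - u t = -b • (u t - v t) by
      obtain rfl : a = 1 - b := by linarith
      module, inner_smul_right, hm0, mul_zero])
  have hn' := mem_normalCone_of_inner_eq_zero (z' := a • u t + b • v t) hn (by
    rw [show a • u t + b • v t - v t = a • (u t - v t) by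
      obtain rfl : b = 1 - a := by linarith
      module, inner_smul_right, hn0, mul_zero])
  have hderiv := ((hut ht).fun_const_smul a).fun_add ((hvt ht).fun_const_smul b)
  refine (eq_sub_proj_of_hasDerivAt hderiv (hpos.mono hmem) ?_) ▸ hderiv
  convert add_mem_normalCone (hd.sub_mem_normalCone_of_inner_eq_zero hf hK (hu.mem t ht.le)
    (hv.mem t ht.le) hf0 ha hb hab) (add_mem_normalCone (smul_mem_normalCone ha hm')
    (smul_mem_normalCone hb hn')) using 1
  module

variable [FiniteDimensional ℝ E]

theorem IsRecurrentTrajectory.convexCombination (hf : Continuous f) (hK : Convex ℝ K)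
    (hd : DissipativeOn f K) (he : IsEquilibrium f K e) (hu : IsRecurrentTrajectory f K u)
    (hv : IsRecurrentTrajectory f K v) {a b : ℝ} (ha : 0 ≤ a) (hb : 0 ≤ b) (hab : a + b = 1) :
    IsRecurrentTrajectory f K fun t => a • u t + b • v t :=
  ⟨hu.toIsProjTrajectory.convexCombination hf hK hd hv.toIsProjTrajectory
    (fun _ ht => hu.dist_eq hd he hv ht) ha hb hab,
   (hu.mapClusterPt_prodMk hd he hv).continuousAt_comp (f := fun p : E × E => a • p.1 + b • p.2)
    (by fun_prop)⟩

theorem convex_projOmega (hf : Continuous f) (hKcl : IsClosed K) (hK : Convex ℝ K)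
    (hd : DissipativeOn f K) (he : IsEquilibrium f K e) : Convex ℝ (projOmega f K) := by
  intro p hp q hq a b ha hb hab
  obtain ⟨u, hu, rfl⟩ := exists_isRecurrentTrajectory_of_mem_projOmega hf hKcl hd he hp
  obtain ⟨v, hv, rfl⟩ := exists_isRecurrentTrajectory_of_mem_projOmega hf hKcl hd he hq
  exact (hu.convexCombination hf hK hd he hv ha hb hab).mem_projOmega

end ConvexCombination

section Flow

theorem exists_additive_extension_of_bijective {G X : Type*} [AddCommGroup G] [LinearOrder G]
    [IsOrderedAddMonoid G] {S : G → X → X}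
    (hadd : ∀ a b, 0 ≤ a → 0 ≤ b → ∀ x, S (a + b) x = S a (S b x))
    (hbij : ∀ a, 0 ≤ a → Function.Bijective (S a)) :
    ∃ Φ : G → X → X, (∀ s t x, Φ (s + t) x = Φ s (Φ t x)) ∧ ∀ t, 0 ≤ t → Φ t = S t := by
  have hex : ∀ t x, ∃ y, ∀ a b, 0 ≤ a → 0 ≤ b → t = a - b → S b y = S a x := by
    intro t x
    obtain ⟨w, rfl⟩ := (hbij t⁻ (negPart_nonneg t)).surjective x
    refine ⟨S t⁺ w, fun a b ha hb hab => ?_⟩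
    rw [← hadd b _ hb (posPart_nonneg t), ← hadd a _ ha (negPart_nonneg t)]
    rw [← posPart_sub_negPart t, sub_eq_sub_iff_add_eq_add] at hab
    rw [add_comm b, hab]
  choose Φ hΦ using hex
  have hpos : ∀ t, 0 ≤ t → Φ t = S t := fun t ht => funext fun x => by
    refine (hbij 0 le_rfl).injective ?_
    rw [hΦ t x t 0 ht le_rfl (sub_zero t).symm, ← hadd 0 t le_rfl ht, zero_add]
  refine ⟨Φ, fun s t x => ?_, hpos⟩
  have hs := hΦ s (Φ t x) s⁺ s⁻ (posPart_nonneg s) (negPart_nonneg s) (posPart_sub_negPart s).symm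
  have ht := hΦ t x t⁺ t⁻ (posPart_nonneg t) (negPart_nonneg t) (posPart_sub_negPart t).symm
  have hst := hΦ (s + t) x (s⁺ + t⁺) (t⁻ + s⁻) (by positivity) (by positivity) (by
    nth_rewrite 1 [← posPart_sub_negPart s, ← posPart_sub_negPart t]
    abel)
  refine (hbij (t⁻ + s⁻) (by positivity)).injective ?_
  rw [hst, hadd _ _ (negPart_nonneg t) (negPart_nonneg s), hs,
    ← hadd _ _ (negPart_nonneg t) (posPart_nonneg s), add_comm t⁻,
    hadd _ _ (posPart_nonneg s) (negPart_nonneg t), ht,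
    hadd _ _ (posPart_nonneg s) (posPart_nonneg t)]

theorem exists_flow_of_semiflow {X : Type*} [MetricSpace X] {S : ℝ → X → X}
    (hadd : ∀ a b, 0 ≤ a → 0 ≤ b → ∀ x, S (a + b) x = S a (S b x))
    (hiso : ∀ a, 0 ≤ a → Isometry (S a)) (hsurj : ∀ a, 0 ≤ a → Function.Surjective (S a))
    (hcont : ∀ x, ContinuousOn (fun t => S t x) (Ici 0)) :
    ∃ Ψ : Flow ℝ X, (∀ t, Isometry (Ψ t)) ∧ ∀ t, 0 ≤ t → ∀ x, Ψ t x = S t x := by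
  obtain ⟨Φ, hΦadd, hΦ⟩ := exists_additive_extension_of_bijective hadd
    fun a ha => ⟨(hiso a ha).injective, hsurj a ha⟩
  have hiso' : ∀ t, Isometry (Φ t) := fun t => Isometry.of_dist_eq fun x y => by
    have ht : 0 ≤ |t| + t := by linarith [neg_abs_le t]
    rw [← (hiso |t| (abs_nonneg t)).dist_eq, ← hΦ _ (abs_nonneg t), ← hΦadd, ← hΦadd, hΦ _ ht,
      (hiso _ ht).dist_eq]
  have hzero : ∀ x, Φ 0 x = x := fun x => (hiso' 0).injective (by rw [← hΦadd, add_zero])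
  have hcont' : ∀ x, Continuous fun t => Φ t x := by
    refine fun x => continuous_iff_continuousAt.2 fun t₀ => ?_
    obtain ⟨N, hN⟩ : ∃ N, 0 < t₀ + N := ⟨1 - t₀, by linarith⟩
    have hS : ContinuousAt (fun t => S (t + N) (Φ (-N) x)) t₀ :=
      ((hcont (Φ (-N) x)).continuousAt (Ici_mem_nhds hN)).comp (f := (· + N)) (by fun_prop)
    refine hS.congr ?_
    filter_upwards [(continuous_add_const N).continuousAt.eventually (lt_mem_nhds hN)] with t ht
    rw [← hΦ _ ht.le, ← hΦadd, add_neg_cancel_right]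
  exact ⟨⟨Φ, continuous_prod_of_continuous_lipschitzWith' _ 1 (fun t => (hiso' t).lipschitz) hcont',
    hΦadd, hzero⟩, hiso', fun t ht x => congrFun (hΦ t ht) x⟩

theorem exists_flow_projOmega {E : Type*} [NormedAddCommGroup E] [InnerProductSpace ℝ E]
    [FiniteDimensional ℝ E] {f : E → E} {K : Set E} {e : E} (hf : Continuous f) (hK : IsClosed K)
    (hd : DissipativeOn f K) (he : IsEquilibrium f K e) :
    ∃ Ψ : Flow ℝ (projOmega f K), (∀ t, Isometry (Ψ t)) ∧
      ∀ p, IsRecurrentTrajectory f K fun t => (Ψ t p : E) := by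
  choose U hU hU0 using fun p : projOmega f K =>
    exists_isRecurrentTrajectory_of_mem_projOmega hf hK hd he p.2
  have hmem : ∀ t p, 0 ≤ t → ∃ q : projOmega f K, (q : E) = U p t := fun t p ht =>
    ⟨⟨U p t, by simpa only [add_zero] using ((hU p).comp_const_add hd ht).mem_projOmega⟩, rfl⟩
  choose! S hS using hmem
  have heq : ∀ {u}, IsRecurrentTrajectory f K u → ∀ p : projOmega f K, u 0 = p →
      EqOn (U p) u (Ici 0) := fun hu p h0 =>
    (hU p).eqOn_of_eq hd hu.toIsProjTrajectory ((hU0 p).trans h0.symm)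
  have hadd : ∀ a b, 0 ≤ a → 0 ≤ b → ∀ p, S (a + b) p = S a (S b p) := fun a b ha hb p => by
    refine Subtype.ext ?_
    rw [hS _ _ (add_nonneg ha hb), hS _ _ ha, add_comm]
    exact (heq ((hU p).comp_const_add hd hb) (S b p) (by rw [add_zero, hS b p hb]) ha).symm
  have hiso : ∀ a, 0 ≤ a → Isometry (S a) := fun a ha => Isometry.of_dist_eq fun p q => by
    rw [Subtype.dist_eq, hS a p ha, hS a q ha, (hU p).dist_eq hd he (hU q) ha, hU0, hU0,
      Subtype.dist_eq]
  have hsurj : ∀ a, 0 ≤ a → Function.Surjective (S a) := fun a ha p => by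
    obtain ⟨v, hv, hva⟩ := (hU p).exists_backward hf hK hd he ha
    refine ⟨⟨v 0, hv.mem_projOmega⟩, Subtype.ext ?_⟩
    rw [hS _ _ ha, heq hv _ rfl ha, hva, hU0]
  have hcont : ∀ p, ContinuousOn (fun t => S t p) (Ici 0) := fun p =>
    IsInducing.subtypeVal.continuousOn_iff.2 ((hU p).continuousOn.congr fun t ht => hS t p ht)
  obtain ⟨Ψ, hΨ, hΨS⟩ := exists_flow_of_semiflow hadd hiso hsurj hcont
  refine ⟨Ψ, hΨ, fun p => (hU p).congr fun t ht => ?_⟩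
  rw [hΨS t ht, hS t p ht]

end Flow

section Faces

variable {E : Type*} [NormedAddCommGroup E] [InnerProductSpace ℝ E] {K A : Set E}

theorem mem_minimalFace_of_openSegment {m p q : E} (hm : m ∈ A) (hp : p ∈ K) (hq : q ∈ K)
    (h : m ∈ openSegment ℝ p q) : p ∈ minimalFace K A :=
  mem_sInter.2 fun _ hF => hF.1.2.left_mem_of_mem_openSegment hp hq (hF.2 hm) h

theorem isFace_of_mem_normalCone (hK : Convex ℝ K) {u n : E} (hn : n ∈ normalCone K u) :
    IsFace K {q | q ∈ K ∧ inner ℝ n (q - u) = 0} := by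
  have hcomb : ∀ x y : E, ∀ a b : ℝ, a + b = 1 →
      inner ℝ n (a • x + b • y - u) = a * inner ℝ n (x - u) + b * inner ℝ n (y - u) := by
    intro x y a b hab
    obtain rfl : a = 1 - b := by linarith
    rw [show (1 - b) • x + b • y - u = (1 - b) • (x - u) + b • (y - u) by module,
      inner_add_right, inner_smul_right, inner_smul_right]
  refine ⟨fun x hx y hy a b ha hb hab => ⟨hK hx.1 hy.1 ha hb hab, ?_⟩,
    ⟨fun q hq => hq.1, fun x hx y hy z hz hxy => ⟨hx, ?_⟩⟩⟩
  · rw [hcomb x y a b hab, hx.2, hy.2, mul_zero, mul_zero, add_zero]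
  · obtain ⟨a, b, ha, hb, hab, rfl⟩ := hxy
    have hsum := hz.2
    rw [hcomb x y a b hab] at hsum
    have hyle := mul_nonpos_of_nonneg_of_nonpos hb.le (hn y hy)
    exact le_antisymm (hn x hx) (nonneg_of_mul_nonneg_right (by linarith) ha)

theorem inner_sub_eq_zero_of_mem_affineSpan {u n w : E} (h : ∀ q ∈ A, inner ℝ n (q - u) = 0)
    (hw : w ∈ affineSpan ℝ A) : inner ℝ n (w - u) = 0 := by
  refine affineSpan_induction hw h fun c x y z hx hy hz => ?_
  rw [vsub_eq_sub, vadd_eq_add, add_sub_assoc, ← sub_sub_sub_cancel_right x y u, inner_add_right,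
    inner_smul_right, inner_sub_right, hx, hy, hz, sub_zero, mul_zero, add_zero]

theorem sub_proj_normalCone_affineSubspace (V : AffineSubspace ℝ E)
    [V.direction.HasOrthogonalProjection] {z : E} (hz : z ∈ V) (v : E) :
    v - proj (normalCone (V : Set E) z) v = V.direction.starProjection v := by
  have hdir : V.direction.starProjection v ∈ V.direction := Submodule.starProjection_apply_mem _ _
  have horth : v - V.direction.starProjection v ∈ V.directionᗮ :=
    Submodule.sub_starProjection_mem_orthogonal v
  have hproj : proj (normalCone (V : Set E) z) v = v - V.direction.starProjection v := by
    refine proj_eq_of_inner_le (fun w hw => ?_) fun q hq => ?_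
    · rw [real_inner_comm]
      exact (horth _ (AffineSubspace.vsub_mem_direction hw hz)).le
    · have hq' := hq (V.direction.starProjection v +ᵥ z)
        (AffineSubspace.vadd_mem_of_mem_direction hdir hz)
      rw [vadd_eq_add, add_sub_cancel_right, real_inner_comm] at hq'
      rwa [sub_sub_cancel, inner_sub_right, horth _ hdir, sub_zero]
  rw [hproj, sub_sub_cancel]

end Faces

section HomothetyCore

variable {E : Type*} [NormedAddCommGroup E]

theorem exists_ball_inter_affineSpan_subset [NormedSpace ℝ E] [FiniteDimensional ℝ E] {Q : Set E}
    (hQ : Convex ℝ Q) (hne : Q.Nonempty) :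
    ∃ x ∈ Q, ∃ r > 0, Metric.ball x r ∩ affineSpan ℝ Q ⊆ Q := by
  obtain ⟨x, hx⟩ := hne.intrinsicInterior hQ
  obtain ⟨y, hy, rfl⟩ := mem_intrinsicInterior.1 hx
  obtain ⟨r, hr, hball⟩ := Metric.mem_nhds_iff.1 (mem_interior_iff_mem_nhds.1 hy)
  exact ⟨y, intrinsicInterior_subset hx, r, hr, fun x hx =>
    hball (show (⟨x, hx.2⟩ : affineSpan ℝ Q) ∈ Metric.ball y r from hx.1)⟩

/-- The points `x` of `Q` for which the homothety of ratio `-c` centred at `x` maps `Q` to itself: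
a closed substitute for the relative interior of a convex set. -/
def homothetyCore [NormedSpace ℝ E] (Q : Set E) (c : ℝ) : Set E :=
  {x ∈ Q | ∀ y ∈ Q, x + c • (x - y) ∈ Q}

theorem convexCombination_eq_iff [NormedSpace ℝ E] {x y w : E} {c : ℝ} (hc : 0 < c) :
    (c / (1 + c)) • y + (1 / (1 + c)) • w = x ↔ w = x + c • (x - y) := by
  refine ⟨?_, ?_⟩ <;> rintro rfl <;> match_scalars <;> field_simp <;> ring

theorem convex_homothetyCore [NormedSpace ℝ E] {Q : Set E} (hQ : Convex ℝ Q) (c : ℝ) :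
    Convex ℝ (homothetyCore Q c) := by
  refine fun x hx x' hx' a b ha hb hab => ⟨hQ hx.1 hx'.1 ha hb hab, fun y hy => ?_⟩
  convert! hQ (hx.2 y hy) (hx'.2 y hy) ha hb hab using 1
  obtain rfl : a = 1 - b := by linarith
  module

theorem isClosed_homothetyCore [NormedSpace ℝ E] {Q : Set E} (hQ : IsClosed Q) (c : ℝ) :
    IsClosed (homothetyCore Q c) := by
  have hinter : homothetyCore Q c = Q ∩ ⋂ y ∈ Q, (fun x => x + c • (x - y)) ⁻¹' Q := by
    ext x
    simp only [homothetyCore, mem_ofPred_eq, mem_inter_iff, mem_iInter, mem_preimage]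
  rw [hinter]
  exact hQ.inter (isClosed_biInter fun y _ => hQ.preimage (by fun_prop))

theorem exists_nonempty_homothetyCore [NormedSpace ℝ E] [FiniteDimensional ℝ E] {Q : Set E}
    (hQ : Convex ℝ Q) (hne : Q.Nonempty) (hbdd : Bornology.IsBounded Q) :
    ∃ c, 0 < c ∧ (homothetyCore Q c).Nonempty := by
  obtain ⟨x, hx, r, hr, hball⟩ := exists_ball_inter_affineSpan_subset hQ hne
  have hD : 0 < Metric.diam Q + 1 := by linarith [Metric.diam_nonneg (s := Q)]
  refine ⟨r / (Metric.diam Q + 1), by positivity, x, hx, fun y hy => hball ⟨?_, ?_⟩⟩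
  · rw [Metric.mem_ball, dist_eq_norm, add_sub_cancel_left, norm_smul,
      Real.norm_of_nonneg (by positivity), ← dist_eq_norm]
    calc r / (Metric.diam Q + 1) * dist x y
        ≤ r / (Metric.diam Q + 1) * Metric.diam Q := by
          gcongr
          exact Metric.dist_le_diam_of_mem hbdd hx hy
      _ < r / (Metric.diam Q + 1) * (Metric.diam Q + 1) := by gcongr; linarith
      _ = r := div_mul_cancel₀ r hD.ne'
  · rw [add_comm]
    exact AffineSubspace.smul_vsub_vadd_mem _ _ (subset_affineSpan ℝ Q hx)
      (subset_affineSpan ℝ Q hy) (subset_affineSpan ℝ Q hx)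

theorem eq_proj_of_dist_eq [InnerProductSpace ℝ E] [CompleteSpace E] {Q : Set E} {e x : E}
    (hcl : IsClosed Q) (hconv : Convex ℝ Q) (hx : x ∈ Q) (h : dist x e = dist (proj Q e) e) :
    x = proj Q e := by
  have hsq := norm_sq_add_norm_sq_le_of_inner_nonpos ((proj_spec ⟨x, hx⟩ hcl hconv e).2 x hx)
  rw [← dist_eq_norm, ← dist_eq_norm e x, dist_comm e, dist_comm e, h] at hsq
  exact sub_eq_zero.1 (norm_eq_zero.1 (pow_eq_zero_iff two_ne_zero |>.1
    (le_antisymm (by linarith) (sq_nonneg _))))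

end HomothetyCore

section MinimalFace

variable {E : Type*} [NormedAddCommGroup E] [InnerProductSpace ℝ E]

theorem isEquilibrium_of_isProjTrajectory_const [CompleteSpace E] {f : E → E} {K : Set E} {m : E}
    (hm : IsProjTrajectory f K fun _ => m) : IsEquilibrium f K m := by
  refine ⟨hm.mem 0 le_rfl, ?_⟩
  have : NeBot (ae (volume.restrict (Ioi (0 : ℝ)))) := by
    simp only [ae_restrict_neBot, Real.volume_Ioi, ne_eq, ENNReal.top_ne_zero, not_false_eq_true]
  obtain ⟨t, ht⟩ := ((ae_restrict_iff' measurableSet_Ioi).2 hm.hasDerivAt).exists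
  rw [sub_eq_zero.1 (ht.unique (hasDerivAt_const t m))]
  exact proj_normalCone_mem K m (f m)

variable [FiniteDimensional ℝ E] {f : E → E} {K : Set E} {e : E} {u : ℝ → E}

theorem IsRecurrentTrajectory.mem_projOmega_of_nonneg (hd : DissipativeOn f K)
    (hu : IsRecurrentTrajectory f K u) {t : ℝ} (ht : 0 ≤ t) : u t ∈ projOmega f K := by
  simpa only [add_zero] using (hu.comp_const_add hd ht).mem_projOmega

theorem IsRecurrentTrajectory.dist_isEquilibrium_eq (hd : DissipativeOn f K)
    (he : IsEquilibrium f K e) (hu : IsRecurrentTrajectory f K u) {t : ℝ} (ht : 0 ≤ t) :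
    dist (u t) e = dist (u 0) e :=
  hu.dist_eq hd he he.isRecurrentTrajectory_const ht

theorem IsRecurrentTrajectory.mem_projOmega_inter_closedBall_iff (hd : DissipativeOn f K)
    (he : IsEquilibrium f K e) (hu : IsRecurrentTrajectory f K u) {R t : ℝ} (ht : 0 ≤ t) :
    u t ∈ projOmega f K ∩ Metric.closedBall e R ↔ u 0 ∈ projOmega f K ∩ Metric.closedBall e R := by
  simp only [mem_inter_iff, hu.mem_projOmega_of_nonneg hd ht, hu.mem_projOmega, true_and,
    Metric.mem_closedBall, hu.dist_isEquilibrium_eq hd he ht]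

theorem IsRecurrentTrajectory.mem_homothetyCore (hf : Continuous f) (hKcl : IsClosed K)
    (hK : Convex ℝ K) (hd : DissipativeOn f K) (he : IsEquilibrium f K e)
    (hu : IsRecurrentTrajectory f K u) {R c t : ℝ} (hc : 0 < c) (ht : 0 ≤ t)
    (h0 : u 0 ∈ homothetyCore (projOmega f K ∩ Metric.closedBall e R) c) :
    u t ∈ homothetyCore (projOmega f K ∩ Metric.closedBall e R) c := by
  refine ⟨(hu.mem_projOmega_inter_closedBall_iff hd he ht).2 h0.1, fun y hy => ?_⟩
  obtain ⟨y', hy', rfl⟩ := exists_isRecurrentTrajectory_of_mem_projOmega hf hKcl hd he hy.1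
  obtain ⟨v, hv, hvt⟩ := hy'.exists_backward hf hKcl hd he ht
  rw [← hvt] at hy ⊢
  have hw0 := h0.2 _ ((hv.mem_projOmega_inter_closedBall_iff hd he ht).1 hy)
  obtain ⟨w, hw, hw_eq⟩ := exists_isRecurrentTrajectory_of_mem_projOmega hf hKcl hd he hw0.1
  have hcomb := hv.convexCombination hf hK hd he hw (a := c / (1 + c)) (b := 1 / (1 + c))
    (by positivity) (by positivity) (by field_simp; ring)
  have heq := hcomb.eqOn_of_eq hd hu.toIsProjTrajectory ((convexCombination_eq_iff hc).2 hw_eq) ht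
  rw [← (convexCombination_eq_iff hc).1 heq]
  exact (hw.mem_projOmega_inter_closedBall_iff hd he ht).2 (hw_eq ▸ hw0)

theorem exists_isEquilibrium_mem_openSegment (hf : Continuous f) (hKcl : IsClosed K)
    (hK : Convex ℝ K) (hd : DissipativeOn f K) (he : IsEquilibrium f K e) {p : E}
    (hp : p ∈ projOmega f K) :
    ∃ m, IsEquilibrium f K m ∧ ∃ q ∈ projOmega f K, m ∈ openSegment ℝ p q := by
  let Q := projOmega f K ∩ Metric.closedBall e (dist p e)
  have hpQ : p ∈ Q := ⟨hp, Metric.mem_closedBall.2 le_rfl⟩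
  have hQ : Convex ℝ Q := (convex_projOmega hf hKcl hK hd he).inter (convex_closedBall _ _)
  have hQcl : IsClosed Q := (isClosed_projOmega hf hKcl hd he).inter Metric.isClosed_closedBall
  obtain ⟨c, hc, hne⟩ := exists_nonempty_homothetyCore hQ ⟨p, hpQ⟩
    (Metric.isBounded_closedBall.subset inter_subset_right)
  have hcore := isClosed_homothetyCore hQcl c
  have hcore' := convex_homothetyCore hQ c
  have hm := (proj_spec hne hcore hcore' e).1
  obtain ⟨u, hu, hu0⟩ := exists_isRecurrentTrajectory_of_mem_projOmega hf hKcl hd he hm.1.1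
  -- The flow preserves the core and the distance to `e`, so it fixes the point nearest to `e`.
  have hfixed : ∀ t, 0 ≤ t → u t = proj (homothetyCore Q c) e := fun t ht =>
    eq_proj_of_dist_eq hcore hcore'
      (hu.mem_homothetyCore hf hKcl hK hd he hc ht (hu0 ▸ hm))
      (hu0 ▸ hu.dist_isEquilibrium_eq hd he ht)
  refine ⟨_, isEquilibrium_of_isProjTrajectory_const
    (hu.toIsProjTrajectory.congr fun t ht => (hfixed t ht).symm), _, (hm.2 p hpQ).1, c / (1 + c),
    1 / (1 + c), by positivity, by positivity, by field_simp; ring,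
    (convexCombination_eq_iff hc).2 rfl⟩

/-- The affine span of the minimal face of `K` containing all equilibria. For `f = gradField φ` and
`φ` concave-convex on `K` this is `saddleSpan φ K`. -/
noncomputable def equilibriumSpan {E : Type*} [NormedAddCommGroup E] [InnerProductSpace ℝ E]
    (f : E → E) (K : Set E) : AffineSubspace ℝ E :=
  affineSpan ℝ (minimalFace K {z | IsEquilibrium f K z})

theorem projOmega_subset_equilibriumSpan (hf : Continuous f) (hKcl : IsClosed K) (hK : Convex ℝ K)
    (hd : DissipativeOn f K) (he : IsEquilibrium f K e) :
    projOmega f K ⊆ equilibriumSpan f K := by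
  have hsub : projOmega f K ⊆ K := fun x hx => by
    obtain ⟨u, hu, rfl⟩ := exists_isRecurrentTrajectory_of_mem_projOmega hf hKcl hd he hx
    exact hu.mem 0 le_rfl
  intro p hp
  obtain ⟨m, hm, q, hq, hmem⟩ := exists_isEquilibrium_mem_openSegment hf hKcl hK hd he hp
  exact subset_affineSpan ℝ _ (mem_minimalFace_of_openSegment hm (hsub hp) (hsub hq) hmem)

theorem IsRecurrentTrajectory.mem_equilibriumSpan (hf : Continuous f) (hKcl : IsClosed K)
    (hK : Convex ℝ K) (hd : DissipativeOn f K) (he : IsEquilibrium f K e)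
    (hu : IsRecurrentTrajectory f K u) {t : ℝ} (ht : 0 ≤ t) : u t ∈ equilibriumSpan f K :=
  projOmega_subset_equilibriumSpan hf hKcl hK hd he (hu.mem_projOmega_of_nonneg hd ht)

theorem IsRecurrentTrajectory.inner_sub_isEquilibrium_eq_zero (hd : DissipativeOn f K)
    (he : IsEquilibrium f K e) (hu : IsRecurrentTrajectory f K u) {t : ℝ} (ht : 0 < t) {n : E}
    (hn : n ∈ normalCone K (u t)) (hderiv : HasDerivAt u (f (u t) - n) t) :
    inner ℝ n (e - u t) = 0 := by
  have hdist : ∀ᶠ s in 𝓝 t, dist (u s) e = dist (u t) e := by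
    filter_upwards [lt_mem_nhds ht] with s hs
    rw [hu.dist_isEquilibrium_eq hd he hs.le, hu.dist_isEquilibrium_eq hd he ht.le]
  have horth := (hd.inner_eq_zero_of_dist_eq (v := fun _ => e) (hu.mem t ht.le) he.mem hn
    he.mem_normalCone hderiv (by simpa only [sub_self] using hasDerivAt_const t e) hdist).2.1
  rw [← neg_sub, inner_neg_right, horth, neg_zero]

theorem IsRecurrentTrajectory.ae_hasDerivAt_starProjection (hf : Continuous f) (hKcl : IsClosed K)
    (hK : Convex ℝ K) (hd : DissipativeOn f K) (he : IsEquilibrium f K e)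
    (hu : IsRecurrentTrajectory f K u) :
    ∀ᵐ t : ℝ, 0 < t →
      HasDerivAt u ((equilibriumSpan f K).direction.starProjection (f (u t))) t := by
  have hmem : ∀ t, 0 ≤ t → u t ∈ equilibriumSpan f K := fun t ht =>
    hu.mem_equilibriumSpan hf hKcl hK hd he ht
  filter_upwards [hu.hasDerivAt] with t hderiv ht
  specialize hderiv ht
  have hn := proj_normalCone_mem K (u t) (f (u t))
  have hface := isFace_of_mem_normalCone hK hn
  have hsub : minimalFace K {z | IsEquilibrium f K z} ⊆
      {q | q ∈ K ∧ inner ℝ (proj (normalCone K (u t)) (f (u t))) (q - u t) = 0} :=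
    sInter_subset_of_mem ⟨hface, fun z hz =>
      ⟨hz.mem, hu.inner_sub_isEquilibrium_eq_zero hd hz ht hn hderiv⟩⟩
  have hnV : f (u t) - (f (u t) - proj (normalCone K (u t)) (f (u t))) ∈
      normalCone (equilibriumSpan f K : Set E) (u t) := fun w hw => by
    rw [sub_sub_cancel]
    exact (inner_sub_eq_zero_of_mem_affineSpan (fun q hq => (hsub hq).2) hw).le
  have hmem' : ∀ᶠ s in 𝓝 t, u s ∈ (equilibriumSpan f K : Set E) :=
    (lt_mem_nhds ht).mono fun s hs => hmem s hs.le
  rwa [eq_sub_proj_of_hasDerivAt hderiv hmem' hnV,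
    sub_proj_normalCone_affineSubspace _ (hmem t ht.le)] at hderiv

end MinimalFace

section ClassicalDerivative

theorem hasDerivAt_of_ae_hasDerivAt {F : Type*} [NormedAddCommGroup F] [NormedSpace ℝ F]
    [CompleteSpace F] {u g : ℝ → F} (hu : ∀ T, 0 ≤ T → AbsolutelyContinuousOnInterval u 0 T)
    (hg : ContinuousOn g (Ici 0)) (hderiv : ∀ᵐ t : ℝ, 0 < t → HasDerivAt u (g t) t) {t : ℝ}
    (ht : 0 < t) : HasDerivAt u (g t) t := by
  let G := fun x => ∫ r in (0 : ℝ)..x, g r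
  have hG : ∀ s, 0 < s → HasDerivAt G (g s) s := fun s hs =>
    hasDerivAt_integral_of_continuousOn_Ici hg le_rfl hs
  have hIcc : uIcc (t / 2) (t + 1) ⊆ Ioi 0 := by
    rw [uIcc_of_le (by linarith)]
    exact fun s hs => (half_pos ht).trans_le hs.1
  have hGac : AbsolutelyContinuousOnInterval G (t / 2) (t + 1) := by
    refine ContDiffOn.absolutelyContinuousOnInterval (ContDiffOn.mono ?_ hIcc)
    refine (contDiffOn_one_iff_derivWithin (uniqueDiffOn_Ioi 0)).2
      ⟨fun s hs => (hG s hs).differentiableAt.differentiableWithinAt, ?_⟩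
    refine (hg.mono Ioi_subset_Ici_self).congr fun s hs => ?_
    rw [derivWithin_of_isOpen isOpen_Ioi hs, (hG s hs).deriv]
  have huac : AbsolutelyContinuousOnInterval u (t / 2) (t + 1) :=
    (hu (t + 1) (by linarith)).mono (by
      rw [uIcc_of_le (by linarith), uIcc_of_le (by linarith)]
      exact Icc_subset_Icc_left (half_pos ht).le)
  obtain ⟨C, hC⟩ := (huac.fun_sub hGac).const_of_ae_hasDerivAt_zero (by
    filter_upwards [hderiv] with s hs hmem
    simpa only [sub_self] using (hs (hIcc hmem)).fun_sub (hG s (hIcc hmem)))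
  refine ((hG t ht).const_add C).congr_of_eventuallyEq ?_
  filter_upwards [Ioo_mem_nhds (half_lt_self ht) (lt_add_one t)] with s hs
  rw [← hC s (Icc_subset_uIcc (Ioo_subset_Icc_self hs)), sub_add_cancel]

theorem IsRecurrentTrajectory.hasDerivAt_starProjection {E : Type*} [NormedAddCommGroup E]
    [InnerProductSpace ℝ E] [FiniteDimensional ℝ E] {f : E → E} {K : Set E} {e : E} {u : ℝ → E}
    (hf : Continuous f) (hKcl : IsClosed K) (hK : Convex ℝ K) (hd : DissipativeOn f K)
    (he : IsEquilibrium f K e) (hu : IsRecurrentTrajectory f K u) {t : ℝ} (ht : 0 < t) :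
    HasDerivAt u ((equilibriumSpan f K).direction.starProjection (f (u t))) t :=
  hasDerivAt_of_ae_hasDerivAt
    (g := fun t => (equilibriumSpan f K).direction.starProjection (f (u t))) hu.absolutelyContinuous
    ((ContinuousLinearMap.continuous _).comp_continuousOn (hf.comp_continuousOn hu.continuousOn))
    (hu.ae_hasDerivAt_starProjection hf hKcl hK hd he) ht

end ClassicalDerivative

section Dissipative

variable {E : Type*} [NormedAddCommGroup E] [InnerProductSpace ℝ E] {f : E → E} {C : Set E}

theorem DissipativeOn.of_dist_lt (hC : Convex ℝ C) {δ : ℝ} (hδ : 0 < δ)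
    (h : ∀ a ∈ C, ∀ b ∈ C, dist a b < δ → inner ℝ (f a - f b) (a - b) ≤ 0) :
    DissipativeOn f C := by
  intro z hz w hw
  obtain ⟨N, hN⟩ := exists_nat_gt (‖z - w‖ / δ)
  have hN0 : (0 : ℝ) < N := (div_nonneg (norm_nonneg _) hδ.le).trans_lt hN
  set x : ℕ → E := fun i => w + ((i : ℝ) / N) • (z - w) with hx
  have hxC : ∀ i ≤ N, x i ∈ C := fun i hi =>
    hC.add_smul_sub_mem hw hz ⟨by positivity, div_le_one_of_le₀ (by exact_mod_cast hi) hN0.le⟩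
  have hstep : ∀ i, x (i + 1) - x i = (N : ℝ)⁻¹ • (z - w) := by
    intro i
    simp only [hx, Nat.cast_add, Nat.cast_one, add_div]
    module
  have hdist : ∀ i, dist (x (i + 1)) (x i) < δ := by
    intro i
    rw [dist_eq_norm, hstep, norm_smul, Real.norm_of_nonneg (by positivity), inv_mul_lt_iff₀ hN0]
    rwa [div_lt_iff₀ hδ] at hN
  have hsum : inner ℝ (f z - f w) (z - w) =
      ∑ i ∈ Finset.range N, inner ℝ (f (x (i + 1)) - f (x i)) (z - w) := by
    rw [← sum_inner, Finset.sum_range_sub fun i => f (x i)]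
    simp [hx, hN0.ne']
  rw [hsum]
  refine Finset.sum_nonpos fun i hi => ?_
  have hi : i + 1 ≤ N := Finset.mem_range.1 hi
  have hle := h _ (hxC _ hi) _ (hxC i (by lia)) (hdist i)
  rw [hstep, inner_smul_right] at hle
  exact nonpos_of_mul_nonpos_right hle (by positivity)

theorem DissipativeOn.of_image_homothety (hf : Continuous f) {c : E}
    (h : ∀ ε ∈ Ioo (0 : ℝ) 1, DissipativeOn f ((fun x => ε • c + (1 - ε) • x) '' C)) :
    DissipativeOn f C := by
  intro z hz w hw
  have hcont : Continuous fun ε : ℝ => inner ℝ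
      (f (ε • c + (1 - ε) • z) - f (ε • c + (1 - ε) • w))
      ((ε • c + (1 - ε) • z) - (ε • c + (1 - ε) • w)) := by fun_prop
  have hlim := (hcont.tendsto 0).mono_left (nhdsWithin_le_nhds (s := Ioi 0))
  simp only [sub_zero, one_smul, zero_smul, zero_add] at hlim
  refine le_of_tendsto hlim ?_
  filter_upwards [Ioo_mem_nhdsGT (zero_lt_one' ℝ)] with ε hε
  exact h ε hε _ (mem_image_of_mem _ hz) _ (mem_image_of_mem _ hw)

theorem mem_of_dist_homothety_lt (hC : Convex ℝ C) {c : E} {r ε : ℝ} (hc : c ∈ C)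
    (hball : Metric.ball c r ∩ affineSpan ℝ C ⊆ C) (hε : ε ∈ Ioo (0 : ℝ) 1) {x q : E}
    (hx : x ∈ C) (hq : q ∈ affineSpan ℝ C) (hqx : dist q (ε • c + (1 - ε) • x) < ε * r) :
    q ∈ C := by
  set p := ε • c + (1 - ε) • x with hp
  have hpC : p ∈ C := hC hc hx hε.1.le (sub_nonneg.2 hε.2.le) (by ring)
  have hc' : c + ε⁻¹ • (q - p) ∈ C := by
    refine hball ⟨?_, ?_⟩
    · rwa [Metric.mem_ball, dist_eq_norm, add_sub_cancel_left, norm_smul, Real.norm_of_nonneg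
        (inv_nonneg.2 hε.1.le), inv_mul_lt_iff₀ hε.1, ← dist_eq_norm]
    · have := AffineSubspace.smul_vsub_vadd_mem _ ε⁻¹ hq (subset_affineSpan ℝ C hpC)
        (subset_affineSpan ℝ C hc)
      rwa [vsub_eq_sub, vadd_eq_add, add_comm] at this
  have hq_eq : q = ε • (c + ε⁻¹ • (q - p)) + (1 - ε) • x := by
    rw [smul_add, smul_inv_smul₀ hε.1.ne', hp]
    abel
  rw [hq_eq]
  exact hC hc' hx hε.1.le (sub_nonneg.2 hε.2.le) (by ring)

end Dissipative

section Gradient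

variable {n m : ℕ} {φ : Pt n m → ℝ} {C : Set (Pt n m)}

theorem ConcaveConvexOn.le_fderiv_x {z w : Pt n m} (hC : ConcaveConvexOn C φ)
    (hφ : DifferentiableAt ℝ φ z) (hz : z ∈ C) (hw : pt (xPart w) (yPart z) ∈ C) :
    φ (pt (xPart w) (yPart z)) - φ z ≤ fderiv ℝ φ z (pt (xPart w) (yPart z) - z) := by
  refine fderiv_nonneg_of_segment hφ fun s hs => ?_
  have hconc := (hC.1 (yPart z)).2 (x := xPart z) (by rwa [mem_ofPred_eq, pt_parts]) hw
    (sub_nonneg.2 hs.2) hs.1 (by ring)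
  rw [segment_x]
  simp only [pt_parts, smul_eq_mul] at hconc
  linarith

theorem ConcaveConvexOn.fderiv_y_le {z w : Pt n m} (hC : ConcaveConvexOn C φ)
    (hφ : DifferentiableAt ℝ φ z) (hz : z ∈ C) (hw : pt (xPart z) (yPart w) ∈ C) :
    fderiv ℝ φ z (pt (xPart z) (yPart w) - z) ≤ φ (pt (xPart z) (yPart w)) - φ z := by
  have hneg : -(φ (pt (xPart z) (yPart w)) - φ z) ≤
      fderiv ℝ (-φ) z (pt (xPart z) (yPart w) - z) := by
    refine fderiv_nonneg_of_segment hφ.neg fun s hs => ?_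
    have hconv := (hC.2 (xPart z)).2 (x := yPart z) (by rwa [mem_ofPred_eq, pt_parts]) hw
      (sub_nonneg.2 hs.2) hs.1 (by ring)
    rw [segment_y]
    simp only [pt_parts, smul_eq_mul] at hconv
    simp only [Pi.neg_apply]
    linarith
  rw [fderiv_neg, neg_apply] at hneg
  linarith

theorem ConcaveConvexOn.inner_gradField_le {a b : Pt n m} (hC : ConcaveConvexOn C φ)
    (hφ : Differentiable ℝ φ) (ha : a ∈ C) (hb : b ∈ C) (hba : pt (xPart b) (yPart a) ∈ C)
    (hab : pt (xPart a) (yPart b) ∈ C) :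
    inner ℝ (gradField φ a - gradField φ b) (a - b) ≤ 0 := by
  have h1 := inner_gradField φ a b
  have h2 := inner_gradField φ b a
  rw [← neg_sub a b, inner_neg_right] at h1
  rw [inner_sub_left]
  linarith [hC.le_fderiv_x (hφ a) ha hba, hC.le_fderiv_x (hφ b) hb hab,
    hC.fderiv_y_le (hφ a) ha hab, hC.fderiv_y_le (hφ b) hb hba]

theorem dist_pt_le (a b : Pt n m) : dist (pt (xPart b) (yPart a)) a ≤ dist b a := by
  rw [EuclideanSpace.dist_eq, EuclideanSpace.dist_eq]
  refine Real.sqrt_le_sqrt (Finset.sum_le_sum fun i _ => ?_)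
  rcases i with i | i
  · exact le_rfl
  · simp [pt, yPart]

theorem HasProductSpan.pt_mem (hspan : HasProductSpan C) {a b : Pt n m}
    (ha : a ∈ affineSpan ℝ C) (hb : b ∈ affineSpan ℝ C) :
    pt (xPart a) (yPart b) ∈ affineSpan ℝ C := by
  obtain ⟨A, B, h⟩ := hspan
  exact (h _).2 ⟨((h a).1 ha).1, ((h b).1 hb).2⟩

/-- The mixed points `(x, y')` of two points of `C` may lie outside of `C`, but not if the two
points are close and lie in a homothetic image of `C` towards a relative interior point. -/
theorem ConcaveConvexOn.dissipativeOn_gradField (hφC : ConcaveConvexOn C φ)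
    (hφ : Differentiable ℝ φ) (hf : Continuous (gradField φ)) (hC : Convex ℝ C)
    (hspan : HasProductSpan C) : DissipativeOn (gradField φ) C := by
  rcases C.eq_empty_or_nonempty with rfl | hne
  · simp [DissipativeOn]
  obtain ⟨c, hc, r, hr, hball⟩ := exists_ball_inter_affineSpan_subset hC hne
  refine .of_image_homothety hf (c := c) fun ε hε => ?_
  refine .of_dist_lt (hC.affinity (ε • c) (1 - ε)) (mul_pos hε.1 hr) ?_
  rintro _ ⟨x, hx, rfl⟩ _ ⟨y, hy, rfl⟩ hxy
  have hmem : ∀ u ∈ C, ε • c + (1 - ε) • u ∈ C := fun u hu =>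
    hC hc hu hε.1.le (sub_nonneg.2 hε.2.le) (by ring)
  have hspanC : ∀ u ∈ C, ε • c + (1 - ε) • u ∈ affineSpan ℝ C := fun u hu =>
    subset_affineSpan ℝ C (hmem u hu)
  refine hφC.inner_gradField_le hφ (hmem x hx) (hmem y hy) ?_ ?_
  · refine mem_of_dist_homothety_lt hC hc hball hε hx (hspan.pt_mem (hspanC y hy) (hspanC x hx)) ?_
    exact (dist_pt_le _ _).trans_lt (by rwa [dist_comm])
  · refine mem_of_dist_homothety_lt hC hc hball hε hy (hspan.pt_mem (hspanC x hx) (hspanC y hy)) ?_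
    exact (dist_pt_le _ _).trans_lt hxy

theorem contDiff_gradField {k : WithTop ℕ∞} (hφ : ContDiff ℝ (k + 1) φ) :
    ContDiff ℝ k (gradField φ) := by
  have hgrad : ContDiff ℝ k (gradient φ) :=
    (InnerProductSpace.toDual ℝ (Pt n m)).symm.contDiff.comp (hφ.fderiv_right le_rfl)
  have hcomp := contDiff_euclidean.1 hgrad
  rw [contDiff_euclidean]
  rintro (i | i)
  · exact hcomp (Sum.inl i)
  · exact (hcomp (Sum.inr i)).neg

theorem convex_setOf_pt_left_mem (hC : Convex ℝ C) (y : EuclideanSpace ℝ (Fin m)) :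
    Convex ℝ {x | pt x y ∈ C} := by
  intro x hx x' hx' a b ha hb hab
  have hcombo : pt (a • x + b • x') y = a • pt x y + b • pt x' y := by
    ext i
    rcases i with i | i
    · rfl
    · exact (Convex.combo_self hab (y i)).symm
  rw [mem_ofPred_eq, hcombo]
  exact hC hx hx' ha hb hab

theorem convex_setOf_pt_right_mem (hC : Convex ℝ C) (x : EuclideanSpace ℝ (Fin n)) :
    Convex ℝ {y | pt x y ∈ C} := by
  intro y hy y' hy' a b ha hb hab
  have hcombo : pt x (a • y + b • y') = a • pt x y + b • pt x y' := by
    ext i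
    rcases i with i | i
    · exact (Convex.combo_self hab (x i)).symm
    · rfl
  rw [mem_ofPred_eq, hcombo]
  exact hC hy hy' ha hb hab

theorem ConcaveConvexOn.mono {K : Set (Pt n m)} (hφC : ConcaveConvexOn C φ) (hKC : K ⊆ C)
    (hK : Convex ℝ K) : ConcaveConvexOn K φ :=
  ⟨fun y => (hφC.1 y).subset (fun _ hx => hKC hx) (convex_setOf_pt_left_mem hK y),
    fun x => (hφC.2 x).subset (fun _ hy => hKC hy) (convex_setOf_pt_right_mem hK x)⟩

end Gradient

section Interior

variable {E : Type*} [NormedAddCommGroup E] [InnerProductSpace ℝ E] {f : E → E} {K : Set E} {e : E}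

theorem eventually_add_smul_mem (he : e ∈ interior K) (v : E) :
    ∀ᶠ c : ℝ in 𝓝[>] 0, e + c • v ∈ K := by
  have hcont : Continuous fun c : ℝ => e + c • v := by fun_prop
  refine (hcont.continuousAt.eventually_mem ?_).filter_mono nhdsWithin_le_nhds
  simpa only [zero_smul, add_zero] using mem_interior_iff_mem_nhds.1 he

theorem eq_zero_of_mem_normalCone_of_mem_interior (he : e ∈ interior K) {v : E}
    (hv : v ∈ normalCone K e) : v = 0 := by
  obtain ⟨c, hcK, hc⟩ := ((eventually_add_smul_mem he v).and self_mem_nhdsWithin).exists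
  have hle := hv _ hcK
  rw [add_sub_cancel_left, inner_smul_right] at hle
  exact real_inner_self_nonpos.1 (nonpos_of_mul_nonpos_right hle hc)

theorem IsEquilibrium.mono {C : Set E} (he : IsEquilibrium f C e) (hKC : K ⊆ C) (heK : e ∈ K) :
    IsEquilibrium f K e :=
  ⟨heK, fun w hw => he.mem_normalCone w (hKC hw)⟩

theorem IsEquilibrium.eq_zero_of_mem_interior (he : IsEquilibrium f K e) (hint : e ∈ interior K) :
    f e = 0 :=
  eq_zero_of_mem_normalCone_of_mem_interior hint he.mem_normalCone

theorem minimalFace_eq_of_mem_interior {A : Set E} (hK : Convex ℝ K) (hA : A ⊆ K) (heA : e ∈ A)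
    (he : e ∈ interior K) : minimalFace K A = K := by
  have hface : IsFace K K := ⟨hK, IsExtreme.rfl⟩
  refine subset_antisymm (sInter_subset_of_mem ⟨hface, hA⟩) fun p hp => ?_
  obtain ⟨c, hcK, hc⟩ := ((eventually_add_smul_mem he (e - p)).and self_mem_nhdsWithin).exists
  have hc : 0 < c := hc
  exact mem_minimalFace_of_openSegment heA hp hcK ⟨c / (1 + c), 1 / (1 + c), by positivity,
    by positivity, by field_simp; ring, (convexCombination_eq_iff hc).2 rfl⟩

theorem equilibriumSpan_eq_top (hK : Convex ℝ K) (he : IsEquilibrium f K e)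
    (hint : e ∈ interior K) : equilibriumSpan f K = ⊤ := by
  rw [equilibriumSpan, minimalFace_eq_of_mem_interior hK (A := {z | IsEquilibrium f K z})
    (fun z hz => hz.mem) he hint]
  exact affineSpan_eq_top_of_nonempty_interior ⟨e, interior_mono (subset_convexHull ℝ K) hint⟩

theorem DissipativeOn.inner_hasFDerivAt_nonpos (hd : DissipativeOn f K) {L : E →L[ℝ] E}
    (hL : HasFDerivAt f L e) (he : e ∈ interior K) (v : E) : inner ℝ (L v) v ≤ 0 := by
  refine le_of_tendsto ((hL.hasLineDerivAt v).tendsto_slope_zero_right.inner tendsto_const_nhds) ?_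
  filter_upwards [eventually_add_smul_mem he v, self_mem_nhdsWithin] with s hs hs0
  have hle := hd _ hs _ (interior_subset he)
  rw [add_sub_cancel_left, inner_smul_right] at hle
  rw [real_inner_smul_left]
  exact mul_nonpos_of_nonneg_of_nonpos (inv_nonneg.2 (le_of_lt hs0))
    (nonpos_of_mul_nonpos_right hle hs0)

theorem DissipativeOn.eq_hasFDerivAt_of_inner_eq_zero (hf : Continuous f) (hK : Convex ℝ K)
    (hd : DissipativeOn f K) {L : E →L[ℝ] E} (hL : HasFDerivAt f L e) (he : e ∈ interior K)
    (hfe : f e = 0) {z : E} (hz : z ∈ K) (h0 : inner ℝ (f z) (z - e) = 0) : f z = L (z - e) := by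
  have hlinear : ∀ s ∈ Ioo (0 : ℝ) 1, f (e + s • (z - e)) = s • f z := by
    intro s hs
    have hcone := hd.sub_mem_normalCone_of_inner_eq_zero hf hK hz (interior_subset he)
      (by rwa [hfe, sub_zero]) hs.1.le (sub_nonneg.2 hs.2.le) (by ring : s + (1 - s) = 1)
    have hmem : s • z + (1 - s) • e ∈ interior K :=
      hK.combo_self_interior_mem_interior hz he hs.1.le (sub_pos.2 hs.2) (by ring)
    have hzero := eq_zero_of_mem_normalCone_of_mem_interior hmem hcone
    rw [hfe, smul_zero, add_zero] at hzero
    rw [← sub_eq_zero.1 hzero]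
    congr 1
    module
  refine tendsto_nhds_unique (tendsto_const_nhds.congr' ?_)
    (hL.hasLineDerivAt (z - e)).tendsto_slope_zero_right
  filter_upwards [Ioo_mem_nhdsGT (zero_lt_one' ℝ)] with s hs
  rw [hlinear s hs, hfe, sub_zero, inv_smul_smul₀ hs.1.ne']

theorem inner_map_sub_eq_zero {L : E →L[ℝ] E} (hL : ∀ v, inner ℝ (L v) v ≤ 0) {a b : E}
    (ha : inner ℝ (L a) a = 0) (hb : inner ℝ (L b) b = 0) : inner ℝ (L (a - b)) (a - b) = 0 := by
  have hadd := hL (a + b)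
  have hsub := hL (a - b)
  simp only [map_add, map_sub, inner_add_left, inner_add_right, inner_sub_left,
    inner_sub_right] at hadd hsub ⊢
  linarith

theorem inner_sub_eq_zero_of_dist_const {z : ℝ → E} {v : E} {t c : ℝ} (hz : HasDerivAt z v t)
    (hc : ∀ t, dist (z t) e = c) : inner ℝ v (z t - e) = 0 := by
  have hderiv := (hz.sub_const e).norm_sq
  simp only [← dist_eq_norm, hc] at hderiv
  have hzero := hderiv.unique (hasDerivAt_const t (c ^ 2))
  rw [real_inner_comm]
  linarith

theorem dist_eq_of_hasDerivAt_of_inner_eq_zero {u v u' v' : ℝ → E}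
    (hu : ∀ t, HasDerivAt u (u' t) t) (hv : ∀ t, HasDerivAt v (v' t) t)
    (h : ∀ t, inner ℝ (u' t - v' t) (u t - v t) = 0) (s t : ℝ) :
    dist (u s) (v s) = dist (u t) (v t) := by
  have hderiv : ∀ t, HasDerivAt (fun t => ‖u t - v t‖ ^ 2) 0 t := fun t => by
    simpa only [real_inner_comm (u' t - v' t), h, mul_zero] using ((hu t).fun_sub (hv t)).norm_sq
  rw [dist_eq_norm, dist_eq_norm, ← pow_left_inj₀ (norm_nonneg _) (norm_nonneg _) two_ne_zero]
  exact is_const_of_deriv_eq_zero (fun t => (hderiv t).differentiableAt)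
    (fun t => (hderiv t).deriv) s t

theorem isProjTrajectory_of_hasDerivAt (hf : Continuous f) {z : ℝ → E}
    (hz : ∀ t, HasDerivAt z (f (z t)) t) (hzK : ∀ t, z t ∈ K) : IsProjTrajectory f K z := by
  have hcont : Continuous z := continuous_iff_continuousAt.2 fun t => (hz t).continuousAt
  refine ⟨fun t _ => hzK t, fun T _ => ?_, .of_forall fun t _ => ?_⟩
  · refine ContDiffOn.absolutelyContinuousOnInterval (ContDiff.contDiffOn ?_)
    rw [contDiff_one_iff_deriv, funext fun t => (hz t).deriv]
    exact ⟨fun t => (hz t).differentiableAt, hf.comp hcont⟩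
  · rw [← eq_sub_proj_of_hasDerivAt (hz t) (.of_forall hzK)
      (by rw [sub_self]; exact zero_mem_normalCone K _)]
    exact hz t

theorem isRecurrentTrajectory_of_dist_const [FiniteDimensional ℝ E] (hf : Continuous f)
    (hK : Convex ℝ K) (hd : DissipativeOn f K) (hfe : DifferentiableAt ℝ f e)
    (he : IsEquilibrium f K e) (hint : e ∈ interior K) {z : ℝ → E}
    (hz : ∀ t, HasDerivAt z (f (z t)) t) (hzK : ∀ t, z t ∈ K) {c : ℝ}
    (hc : ∀ t, dist (z t) e = c) : IsRecurrentTrajectory f K z := by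
  have hL := hfe.hasFDerivAt
  have horth : ∀ t, inner ℝ (f (z t)) (z t - e) = 0 := fun t =>
    inner_sub_eq_zero_of_dist_const (hz t) hc
  have hlinear : ∀ t, f (z t) = fderiv ℝ f e (z t - e) := fun t =>
    hd.eq_hasFDerivAt_of_inner_eq_zero hf hK hL hint (he.eq_zero_of_mem_interior hint) (hzK t)
      (horth t)
  have hskew : ∀ s t, inner ℝ (f (z s) - f (z t)) (z s - z t) = 0 := fun s t => by
    have := inner_map_sub_eq_zero (hd.inner_hasFDerivAt_nonpos hL hint)
      (hlinear s ▸ horth s) (hlinear t ▸ horth t)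
    rwa [map_sub, ← hlinear, ← hlinear, sub_sub_sub_cancel_right] at this
  refine isRecurrentTrajectory_of_isometric_shift hd he (isProjTrajectory_of_hasDerivAt hf hz hzK)
    fun r s _ _ => ?_
  have hdist := dist_eq_of_hasDerivAt_of_inner_eq_zero
    (fun t => (hz (t + s)).comp_add_const t s) hz (fun t => hskew _ _) r 0
  rwa [zero_add] at hdist

end Interior

section FlowOnOmega

variable {E : Type*} [NormedAddCommGroup E] [InnerProductSpace ℝ E] {f : E → E} {K C : Set E}
  {e q : E}

/-- The solutions `z : ℝ → E` of `ż = f(z)` that lie at a constant distance from every equilibrium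
of `f` projected to `C`. For `f = gradField φ` and `φ` concave-convex on `C` this is
`constDistSolutions φ C`. -/
def equidistantSolutions (f : E → E) (C : Set E) : Set (ℝ → E) :=
  {z | (∀ t, HasDerivAt z (f (z t)) t) ∧ ∀ q, IsEquilibrium f C q → ∃ c, ∀ t, dist (z t) q = c}

variable {Ψ : Flow ℝ (projOmega f K)}

theorem flow_mem (hΨ : ∀ p, IsRecurrentTrajectory f K fun t => (Ψ t p : E)) (p : projOmega f K)
    (t : ℝ) : (Ψ t p : E) ∈ K := by
  simpa only [Ψ.map_zero_apply] using (hΨ (Ψ t p)).mem 0 le_rfl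

theorem eq_setOf_flow_apply (Ψ : Flow ℝ (projOmega f K)) :
    projOmega f K = {p | ∃ z : ℝ → E, (∃ p, ∀ t, z t = Ψ t p) ∧ ∃ t, z t = p} := by
  ext p
  refine ⟨fun hp => ⟨fun t => Ψ t ⟨p, hp⟩, ⟨⟨p, hp⟩, fun _ => rfl⟩, 0, ?_⟩, ?_⟩
  · simp only [Ψ.map_zero_apply]
  · rintro ⟨z, ⟨p', hz⟩, t, rfl⟩
    exact hz t ▸ (Ψ t p').2

variable [FiniteDimensional ℝ E]

theorem eq_flow (hd : DissipativeOn f K)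
    (hΨ : ∀ p, IsRecurrentTrajectory f K fun t => (Ψ t p : E)) {z : ℝ → E}
    (hz : IsProjTrajectory f K z) {p : projOmega f K} (hp : z 0 = p) {t : ℝ} (ht : 0 ≤ t) :
    z t = Ψ t p :=
  hz.eqOn_of_eq hd (hΨ p).toIsProjTrajectory (by rw [hp, Ψ.map_zero_apply]) ht

theorem hasDerivAt_flow (hf : Continuous f) (hKcl : IsClosed K) (hK : Convex ℝ K)
    (hd : DissipativeOn f K) (he : IsEquilibrium f K e)
    (hΨ : ∀ p, IsRecurrentTrajectory f K fun t => (Ψ t p : E)) (p : projOmega f K) (t : ℝ) :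
    HasDerivAt (fun s => (Ψ s p : E))
      ((equilibriumSpan f K).direction.starProjection (f (Ψ t p))) t := by
  have hshift : ∀ s, Ψ (s + (1 - t)) (Ψ (t - 1) p) = Ψ s p := fun s => by
    rw [← Ψ.map_add, add_assoc, sub_add_sub_cancel', sub_self, add_zero]
  have hderiv := (hΨ (Ψ (t - 1) p)).hasDerivAt_starProjection hf hKcl hK hd he
    (t := t + (1 - t)) (by linarith)
  simpa only [hshift] using hderiv.comp_add_const t (1 - t)

theorem hasDerivAt_flow_of_mem_interior (hf : Continuous f) (hKcl : IsClosed K) (hK : Convex ℝ K)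
    (hd : DissipativeOn f K) (he : IsEquilibrium f K e) (hint : e ∈ interior K)
    (hΨ : ∀ p, IsRecurrentTrajectory f K fun t => (Ψ t p : E)) (p : projOmega f K) (t : ℝ) :
    HasDerivAt (fun s => (Ψ s p : E)) (f (Ψ t p)) t := by
  have hderiv := hasDerivAt_flow hf hKcl hK hd he hΨ p t
  rwa [equilibriumSpan_eq_top hK he hint, AffineSubspace.direction_top,
    Submodule.starProjection_top] at hderiv

theorem flow_mem_equidistantSolutions (hf : Continuous f) (hKC : K ⊆ C) (hd : DissipativeOn f C)
    (hΨ : ∀ p, IsRecurrentTrajectory f K fun t => (Ψ t p : E))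
    (hderiv : ∀ p t, HasDerivAt (fun s => (Ψ s p : E)) (f (Ψ t p)) t) (p : projOmega f K) :
    (fun t => (Ψ t p : E)) ∈ equidistantSolutions f C := by
  refine ⟨hderiv p, fun q hq => ⟨dist (p : E) q, ?_⟩⟩
  have hrec : ∀ p, IsRecurrentTrajectory f C fun t => (Ψ t p : E) := fun p =>
    ⟨isProjTrajectory_of_hasDerivAt hf (hderiv p) fun t => hKC (flow_mem hΨ p t),
      (hΨ p).mapClusterPt⟩
  have hconst : ∀ p t, 0 ≤ t → dist (Ψ t p : E) q = dist (p : E) q := fun p t ht => by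
    simpa only [Ψ.map_zero_apply] using (hrec p).dist_isEquilibrium_eq hd hq ht
  intro t
  rcases le_total 0 t with ht | ht
  · exact hconst p t ht
  · have hback := hconst (Ψ t p) (-t) (neg_nonneg.2 ht)
    rw [← Ψ.map_add, neg_add_cancel, Ψ.map_zero_apply] at hback
    exact hback.symm

theorem exists_eq_flow_of_mem_equidistantSolutions (hf : Continuous f) (hK : Convex ℝ K)
    (hd : DissipativeOn f K) (hKC : K ⊆ C) (hq : IsEquilibrium f C q) (hint : q ∈ interior K)
    (hfq : DifferentiableAt ℝ f q) (hΨ : ∀ p, IsRecurrentTrajectory f K fun t => (Ψ t p : E))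
    {z : ℝ → E} (hz : z ∈ equidistantSolutions f C) (hzK : ∀ t, z t ∈ K) :
    ∃ p, ∀ t, z t = Ψ t p := by
  obtain ⟨c, hc⟩ := hz.2 q hq
  have hrec : ∀ s, IsRecurrentTrajectory f K fun t => z (t + s) := fun s =>
    isRecurrentTrajectory_of_dist_const hf hK hd hfq (hq.mono hKC (interior_subset hint)) hint
      (fun t => (hz.1 (t + s)).comp_add_const t s) (fun t => hzK _) fun t => hc _
  have hmem : ∀ s, z s ∈ projOmega f K := fun s => by
    simpa only [zero_add] using (hrec s).mem_projOmega
  have hflow : ∀ s t, 0 ≤ t → z (t + s) = Ψ t ⟨z s, hmem s⟩ := fun s t ht =>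
    eq_flow hd hΨ (hrec s).toIsProjTrajectory (by rw [zero_add]) ht
  refine ⟨⟨z 0, hmem 0⟩, fun t => ?_⟩
  rcases le_total 0 t with ht | ht
  · simpa only [add_zero] using hflow 0 t ht
  · have hback : (⟨z 0, hmem 0⟩ : projOmega f K) = Ψ (-t) ⟨z t, hmem t⟩ :=
      Subtype.ext (by simpa only [neg_add_cancel] using hflow t (-t) (neg_nonneg.2 ht))
    rw [hback, ← Ψ.map_add, add_neg_cancel, Ψ.map_zero_apply]

theorem setOf_eq_flow_eq (hf : Continuous f) (hKcl : IsClosed K) (hK : Convex ℝ K) (hKC : K ⊆ C)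
    (hd : DissipativeOn f C) (hq : IsEquilibrium f C q) (hint : q ∈ interior K)
    (hfq : DifferentiableAt ℝ f q) (hΨ : ∀ p, IsRecurrentTrajectory f K fun t => (Ψ t p : E)) :
    {z : ℝ → E | ∃ p, ∀ t, z t = Ψ t p} = {z | z ∈ equidistantSolutions f C ∧ ∀ t, z t ∈ K} := by
  refine Subset.antisymm ?_ fun z hz =>
    exists_eq_flow_of_mem_equidistantSolutions hf hK (hd.mono hKC) hKC hq hint hfq hΨ hz.1 hz.2
  rintro z ⟨p, hp⟩
  obtain rfl : z = fun t => (Ψ t p : E) := funext hp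
  exact ⟨flow_mem_equidistantSolutions hf hKC hd hΨ (hasDerivAt_flow_of_mem_interior hf hKcl hK
    (hd.mono hKC) (hq.mono hKC (interior_subset hint)) hint hΨ) p, flow_mem hΨ p⟩

end FlowOnOmega

section SubgradientMethod

variable {n m : ℕ} {φ : Pt n m → ℝ} {K : Set (Pt n m)}

theorem isSubgradTrajectory_iff_isProjTrajectory {z : ℝ → Pt n m} :
    IsSubgradTrajectory φ K z ↔ IsProjTrajectory (gradField φ) K z :=
  ⟨fun h => ⟨h.mem, h.absolutelyContinuous, h.hasDerivAt⟩,
    fun h => ⟨h.mem, h.absolutelyContinuous, h.hasDerivAt⟩⟩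

theorem omegaLimitSet_eq_projOmega : omegaLimitSet φ K = projOmega (gradField φ) K := by
  ext p
  simp only [omegaLimitSet, projOmega, mem_ofPred_eq, isSubgradTrajectory_iff_isProjTrajectory,
    mapClusterPt_atTop_iff_forall_mem_closure]
  exact exists_congr fun z => and_congr_right fun _ =>
    ⟨fun h t => closure_mono (image_mono (Ici_subset_Ici.2 (le_max_left t 0)))
      (h _ (le_max_right t 0)), fun h t _ => h t⟩

theorem isRestrictedSaddle_iff_isEquilibrium (hφ : Differentiable ℝ φ)
    (hφK : ConcaveConvexOn K φ) {z : Pt n m} :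
    IsRestrictedSaddle φ K z ↔ IsEquilibrium (gradField φ) K z :=
  (isRestrictedSaddle_iff_mem_normalCone hφ hφK).trans
    ⟨fun h => ⟨h.1, h.2⟩, fun h => ⟨h.mem, h.mem_normalCone⟩⟩

theorem saddleSpan_eq_equilibriumSpan (hφ : Differentiable ℝ φ) (hφK : ConcaveConvexOn K φ) :
    saddleSpan φ K = equilibriumSpan (gradField φ) K := by
  simp only [saddleSpan, equilibriumSpan, isRestrictedSaddle_iff_isEquilibrium hφ hφK]

theorem constDistSolutions_eq_equidistantSolutions (hφ : Differentiable ℝ φ)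
    (hφK : ConcaveConvexOn K φ) :
    constDistSolutions φ K = equidistantSolutions (gradField φ) K := by
  simp only [constDistSolutions, equidistantSolutions,
    isRestrictedSaddle_iff_isEquilibrium hφ hφK]

end SubgradientMethod

end SubgradientFaces

open SubgradientFaces in
theorem mainTheorem2_general {E : Type*} [NormedAddCommGroup E] [InnerProductSpace ℝ E]
    [FiniteDimensional ℝ E] {f : E → E} {K C : Set E}
    (hf : Continuous f) (hKcl : IsClosed K) (hK : Convex ℝ K)
    (hKC : K ⊆ C) (hd : DissipativeOn f C) (he : ∃ e, IsEquilibrium f K e) :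
    Convex ℝ (projOmega f K) ∧
    ∃ Ψ : Flow ℝ (projOmega f K),
      (∀ t, Isometry (Ψ t)) ∧
      (∀ p, IsProjTrajectory f K fun t => (Ψ t p : E)) ∧
      (∀ z, IsProjTrajectory f K z → ∀ p : projOmega f K, z 0 = p → ∀ t, 0 ≤ t → z t = Ψ t p) ∧
      (∀ p t, (Ψ t p : E) ∈ equilibriumSpan f K ∧
        HasDerivAt (fun s => (Ψ s p : E))
          (f (Ψ t p) - proj (normalCone (equilibriumSpan f K : Set E) (Ψ t p)) (f (Ψ t p))) t) ∧
      ((∃ q ∈ interior K, IsEquilibrium f C q ∧ DifferentiableAt ℝ f q) →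
        {z : ℝ → E | ∃ p, ∀ t, z t = Ψ t p} =
            {z | z ∈ equidistantSolutions f C ∧ ∀ t, z t ∈ K} ∧
          projOmega f K =
            {p | ∃ z ∈ equidistantSolutions f C, (∀ t, z t ∈ K) ∧ ∃ t, z t = p}) := by
  obtain ⟨e, he⟩ := he
  have hdK := hd.mono hKC
  have hspan := projOmega_subset_equilibriumSpan hf hKcl hK hdK he
  obtain ⟨Ψ, hisometry, hΨ⟩ := exists_flow_projOmega hf hKcl hdK he
  refine ⟨convex_projOmega hf hKcl hK hdK he, Ψ, hisometry, fun p => (hΨ p).toIsProjTrajectory,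
    fun z hz p hp t ht => eq_flow hdK hΨ hz hp ht, fun p t => ⟨hspan (Ψ t p).2, ?_⟩, ?_⟩
  · rw [sub_proj_normalCone_affineSubspace _ (hspan (Ψ t p).2)]
    exact hasDerivAt_flow hf hKcl hK hdK he hΨ p t
  · rintro ⟨q, hint, hq, hfq⟩
    have horbits := setOf_eq_flow_eq hf hKcl hK hKC hd hq hint hfq hΨ
    refine ⟨horbits, (eq_setOf_flow_apply Ψ).trans (ext fun p => exists_congr fun z => ?_)⟩
    rw [← and_assoc]
    exact and_congr_left fun _ => Set.ext_iff.1 horbits z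

open SubgradientFaces in
theorem mainTheorem2 {n m : ℕ} (K C : Set (Pt n m)) (φ : Pt n m → ℝ)
    (hKclosed : IsClosed K) (hKconvex : Convex ℝ K)
    (hφ : ContDiff ℝ 2 φ)
    (hKC : K ⊆ C) (hC : Convex ℝ C) (hCspan : HasProductSpan C) (hφC : ConcaveConvexOn C φ)
    (hsaddle : ∃ z, IsRestrictedSaddle φ K z) :
    Convex ℝ (omegaLimitSet φ K) ∧
    ∃ Ψ : Flow ℝ (omegaLimitSet φ K),
      -- `Ψ` is a flow of isometries
      (∀ t, Isometry (Ψ t)) ∧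
      -- for `t ≥ 0` it is the subgradient method on `K` started in `Ω`
      (∀ p, IsSubgradTrajectory φ K (fun t => (Ψ t p : Pt n m))) ∧
      (∀ z, IsSubgradTrajectory φ K z → ∀ p : omegaLimitSet φ K, z 0 = p →
        ∀ t, 0 ≤ t → z t = Ψ t p) ∧
      -- (i) its trajectories solve the subgradient method on the affine subspace `V`
      (∀ p t, (Ψ t p : Pt n m) ∈ saddleSpan φ K ∧
        HasDerivAt (fun s => (Ψ s p : Pt n m))
          (subgradField φ (saddleSpan φ K : Set (Pt n m)) (Ψ t p)) t) ∧
      -- (ii) the case of a saddle point in the interior of `K`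
      ((∃ z ∈ interior K, IsRestrictedSaddle φ C z) →
        {z : ℝ → Pt n m | ∃ p, ∀ t, z t = Ψ t p} =
            {z | z ∈ constDistSolutions φ C ∧ ∀ t, z t ∈ K} ∧
          omegaLimitSet φ K =
            {p | ∃ z ∈ constDistSolutions φ C, (∀ t, z t ∈ K) ∧ ∃ t, z t = p}) := by
  have hφd : Differentiable ℝ φ := hφ.differentiable two_ne_zero
  have hf : ContDiff ℝ 1 (gradField φ) := contDiff_gradField (by rwa [one_add_one_eq_two])
  have hφK : ConcaveConvexOn K φ := hφC.mono hKC hKconvex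
  rw [omegaLimitSet_eq_projOmega]
  simp only [isSubgradTrajectory_iff_isProjTrajectory, saddleSpan_eq_equilibriumSpan hφd hφK,
    constDistSolutions_eq_equidistantSolutions hφd hφC,
    isRestrictedSaddle_iff_isEquilibrium hφd hφC]
  simp only [isRestrictedSaddle_iff_isEquilibrium hφd hφK] at hsaddle
  obtain ⟨hconvex, Ψ, hisometry, htraj, hunique, hspan, hint⟩ := mainTheorem2_general hf.continuous
    hKclosed hKconvex hKC (hφC.dissipativeOn_gradField hφd hf.continuous hC hCspan) hsaddle
  exact ⟨hconvex, Ψ, hisometry, htraj, hunique, hspan, fun ⟨q, hqK, hq⟩ =>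
    hint ⟨q, hqK, hq, hf.differentiable one_ne_zero q⟩⟩
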